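/- A *tracial $W^*$-probability space* $(\mathcal A,\varphi)$ is a von Neumann algebra $\mathcal A$ with a (faithful) normal tracial state $\varphi$. Elements $a,b\in\mathcal A$ are *freely independent* if $\varphi(x_1\cdots x_n)=0$ whenever $n\ge 1$, the $x_k$ lie alternately in the unital $*$-subalgebras generated by $a$ and by $b$, and $\varphi(x_k)=0$ for all $k$. For a projection $e\in\mathcal A$, let $\mathcal S(e)$ be the set of all self-adjoint $y\in\mathcal A$ that are freely independent from $e$ and for which the distribution of $e+y$ is symmetric about $0$, i.e. $\varphi\big((e+y)^{2k+1}\big)=0$ for all $k\ge 0$. **Theorem.** Let $p\in[0,1]\setminus\{\tfrac12\}$. 1. Let $(\mathcal A,\varphi)$ be a tracial $W^*$-probability space and $e\in\mathcal A$ a projection with $\varphi(e)=p$. Then $\varphi(y^2)\ge p$ for every $y\in\mathcal S(e)$. If $y\in\mathcal A$ is self-adjoint, freely independent from $e$ and distributed as $-e$ (that is, $\varphi(y^n)=\varphi((-e)^n)$ for all $n\ge 0$), then $y\in\mathcal S(e)$ and $\varphi(y^2)=p$, so that $\min_{x\in\mathcal S(e)}\varphi(x^2)=p$. This part does not need $\varphi$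 to be faithful. 2. There are a tracial $W^*$-probability space $(\mathcal A,\varphi)$ with $\varphi$ faithful, a projection $e\in\mathcal A$ with $\varphi(e)=p$, and $y\in\mathcal S(e)$ distributed as $-e$. Hence the minimal value of $\varphi(y^2)$ over all such $y$ is exactly $p$, and it is attained. -/

import Mathlib

/-- The ultraweakly continuous functionals on a von Neumann algebra `M` acting on `H`:
`φ a = ∑ₙ ⟪ξₙ, a ηₙ⟫` for two square-summable sequences of vectors of `H`. -/
def IsNormalFunctional {H : Type*} [NormedAddCommGroup H] [InnerProductSpace ℂ H]
    [CompleteSpace H] (M : VonNeumannAlgebra H) (φ : M.toStarSubalgebra →ₗ[ℂ] ℂ) : Prop :=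
  ∃ ξ η : ℕ → H, (Summable fun n => ‖ξ n‖ ^ 2) ∧ (Summable fun n => ‖η n‖ ^ 2) ∧
    ∀ a : M.toStarSubalgebra, HasSum (fun n => inner ℂ (ξ n) ((a : H →L[ℂ] H) (η n))) (φ a)

/-- `φ` is a normal tracial state on the von Neumann algebra `M`. -/
structure IsNormalTracialState {H : Type*} [NormedAddCommGroup H] [InnerProductSpace ℂ H]
    [CompleteSpace H] (M : VonNeumannAlgebra H) (φ : M.toStarSubalgebra →ₗ[ℂ] ℂ) : Prop where
  map_one : φ 1 = 1
  re_nonneg : ∀ a, 0 ≤ (φ (star a * a)).re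
  im_eq_zero : ∀ a, (φ (star a * a)).im = 0
  tracial : ∀ a b, φ (a * b) = φ (b * a)
  normal : IsNormalFunctional M φ

/-- Faithfulness of a positive functional. -/
def IsFaithfulFunctional {A : Type*} [Ring A] [StarRing A] [Algebra ℂ A]
    (φ : A →ₗ[ℂ] ℂ) : Prop :=
  ∀ a : A, φ (star a * a) = 0 → a = 0

/-- Free independence of a family of unital `*`-subalgebras: every nonempty alternating product
of centred elements is centred. -/
def FreeSubalgebras {A : Type*} [Ring A] [StarRing A] [Algebra ℂ A] [StarModule ℂ A]
    (φ : A →ₗ[ℂ] ℂ) {ι : Type*} (B : ι → StarSubalgebra ℂ A) : Prop :=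
  ∀ (n : ℕ) (i : Fin (n + 1) → ι) (a : Fin (n + 1) → A),
    (∀ k : Fin n, i k.castSucc ≠ i k.succ) →
    (∀ k, a k ∈ B (i k)) → (∀ k, φ (a k) = 0) → φ (List.ofFn a).prod = 0

/-- Two elements are freely independent if the unital `*`-subalgebras that they generate are. -/
def FreelyIndependent {A : Type*} [Ring A] [StarRing A] [Algebra ℂ A] [StarModule ℂ A]
    (φ : A →ₗ[ℂ] ℂ) (a b : A) : Prop :=
  FreeSubalgebras φ ![StarAlgebra.adjoin ℂ {a}, StarAlgebra.adjoin ℂ {b}]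

/-- Self-adjoint elements have the same distribution if all their moments agree. -/
def SameDistribution {A : Type*} [Ring A] [Algebra ℂ A] (φ : A →ₗ[ℂ] ℂ) (a b : A) : Prop :=
  ∀ n : ℕ, φ (a ^ n) = φ (b ^ n)

/-- The self-adjoint `y`, freely independent from `e`, for which the distribution of `e + y` is
symmetric about `0`. -/
def freeSymmetrizers {A : Type*} [Ring A] [StarRing A] [Algebra ℂ A] [StarModule ℂ A]
    (φ : A →ₗ[ℂ] ℂ) (e : A) : Set A :=
  {y | IsSelfAdjoint y ∧ FreelyIndependent φ e y ∧ ∀ k : ℕ, φ ((e + y) ^ (2 * k + 1)) = 0}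

/-!
The functional inverse `K_a` of the Cauchy transform `G_a` satisfies
`K_{e + y}(w) = K_e(w) + K_y(w) - 1 / w` for free `e` and `y`. If `y` is distributed as `-e`, then
`K_y(w) = -K_e(-w)`, so `K_{e + y}` is odd and `e + y` is symmetric.

For the lower bound, suppose that `e + y` is symmetric, so that `G := G_{e + y}` is purely imaginary
on the imaginary axis. Analytic continuation from infinity along the axis turns the identity of the
inverses into `G(i t) = G_e(ω_e) = G_y(ω_y)` with `ω_e + ω_y = i t + 1 / G(i t)`, where `ω_e` is
explicit because `G_e` solves a quadratic equation. The Cauchy-Schwarz inequality for `y` and its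
resolvent at `ω_y` involves only `t`, `G(i t)` and the variance of `y`, and for a projection the
corresponding inequality is an equality. If `y` had a smaller variance than `e`, comparing the two
would show that `ω_e` and `ω_y` never have the same imaginary part. Since `Im ω_e < Im ω_y` for
large `t`, this would persist for all `t > 0`, but it fails at `t = (2 p - 1) ^ 2`.

The minimum is attained in the von Neumann algebra of the Hecke algebra of the infinite dihedral
group: its two generators are free, and their spectral projections have any prescribed trace.
-/

section FreeSymmetrization

open Filter Topology Set

lemma lt_one_of_sqrt_relation {s g A : ℝ} (hs : s ^ 2 < 1) (hg : 0 < g)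
    (h : g ^ 2 * (A ^ 2 - s ^ 2) = A ^ 2 * (1 - A ^ 2)) : A < 1 := by
  by_contra! hA1
  have hA2 : 1 ≤ A ^ 2 := one_le_pow₀ hA1
  have hleft : 0 < g ^ 2 * (A ^ 2 - s ^ 2) := mul_pos (by positivity) (by linarith)
  nlinarith

lemma one_sub_sq_le_of_sqrt_relation {s g A : ℝ} (hA : 0 < A)
    (h : g ^ 2 * (A ^ 2 - s ^ 2) = A ^ 2 * (1 - A ^ 2)) : 1 - g ^ 2 ≤ A ^ 2 := by
  have hmul : A ^ 2 * (1 - g ^ 2) ≤ A ^ 2 * A ^ 2 := by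
    linarith [mul_nonneg (sq_nonneg g) (sq_nonneg s)]
  exact le_of_mul_le_mul_left hmul (by positivity)

lemma one_add_div_sub_one_sub_div (g A : ℝ) :
    (1 + A) / (2 * g) - (1 - A) / (2 * g) = A / g := by
  rw [← sub_div, show 1 + A - (1 - A) = 2 * A by ring, mul_div_mul_left _ _ two_ne_zero]

-- The case of equality in the hypothesis `hV` of `sub_lt_of_lt_mul`: the Cauchy-Schwarz inequality
-- is sharp for a projection.
lemma mul_add_sq_eq_of_sqrt_relation {s g A : ℝ} (hg : 0 < g) (hA : 0 < A)
    (h : g ^ 2 * (A ^ 2 - s ^ 2) = A ^ 2 * (1 - A ^ 2)) :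
    (1 + A) / (2 * g) * ((s / 2 * (1 - 1 / A)) ^ 2 + ((1 - A) / (2 * g)) ^ 2) =
      (1 - s ^ 2) / 4 * ((1 - A) / (2 * g)) := by
  field_simp
  linear_combination 4 * (A - 1) * h

lemma sub_lt_of_lt_mul {b x d t V : ℝ} (ht : 0 < t) (hx : 0 < x)
    (hV : (t + x) * (d ^ 2 + (b - t) ^ 2) ≤ V * (b - t)) (hVx : V < t * x) : b - x < t := by
  by_contra! hc
  have hbt : 0 < b - t := by linarith
  have hmul : t * (b - t) * (b - t) ≤ V * (b - t) := by
    refine le_trans ?_ hV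
    calc t * (b - t) * (b - t) = t * (b - t) ^ 2 := by ring
      _ ≤ (t + x) * (d ^ 2 + (b - t) ^ 2) := by
          gcongr
          · linarith
          · linarith [sq_nonneg d]
  have hle : t * (b - t) ≤ V := le_of_mul_le_mul_right hmul hbt
  have : t * x ≤ t * (b - t) := by gcongr; linarith
  linarith

lemma sub_ne_of_lt_variance {b x d t V σ : ℝ} (hx : 0 < x)
    (hσ : b * (d ^ 2 + x ^ 2) = σ * x)
    (hV : (t + x) * (d ^ 2 + (b - t) ^ 2) ≤ V * (b - t)) (hVσ : V < σ) : b - x ≠ t := by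
  rintro rfl
  rw [sub_add_cancel, sub_sub_cancel, hσ] at hV
  exact hVσ.not_ge (le_of_mul_le_mul_right hV hx)

lemma sq_lt_sq_of_lt_variance {b x d t V σ : ℝ} (ht : 0 < t) (hx : 0 < x) (hb : 0 < b)
    (hd : d ≠ 0) (hV0 : 0 ≤ V) (hσ : b * (d ^ 2 + x ^ 2) = σ * x)
    (hV : (t + x) * (d ^ 2 + (b - t) ^ 2) ≤ V * (b - t)) (hVσ : V < σ) (hbt : b - x < t) :
    d ^ 2 < x ^ 2 := by
  have hy : 0 < b - t := by
    have hpos : 0 < V * (b - t) := lt_of_lt_of_le (by positivity) hV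
    exact pos_of_mul_pos_right hpos hV0
  set y := b - t
  have hyx : y < x := by simp only [y]; linarith
  have hby : b * ((d ^ 2 + y ^ 2) * x) < b * ((d ^ 2 + x ^ 2) * y) := by
    calc b * ((d ^ 2 + y ^ 2) * x) ≤ (t + x) * ((d ^ 2 + y ^ 2) * x) := by gcongr; linarith
      _ = (t + x) * (d ^ 2 + y ^ 2) * x := by ring
      _ ≤ V * y * x := by gcongr
      _ < σ * y * x := by gcongr
      _ = b * ((d ^ 2 + x ^ 2) * y) := by linear_combination (-y) * hσ
  have hmul : d ^ 2 * (x - y) < x * y * (x - y) := by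
    linarith [lt_of_mul_lt_mul_left hby hb.le]
  have hdxy : d ^ 2 < x * y := lt_of_mul_lt_mul_right hmul (by linarith)
  calc d ^ 2 < x * y := hdxy
    _ < x * x := mul_lt_mul_of_pos_left hyx hx
    _ = x ^ 2 := (sq x).symm

lemma tendsto_mul_atTop_one {g : ℝ → ℝ} {m : ℝ}
    (hlow : ∀ t, 0 < t → t ≤ (t ^ 2 + m) * g t) (hup : ∀ t, 0 < t → t * g t ≤ 1) :
    Tendsto (fun t => t * g t) atTop (𝓝 1) := by
  have hden : Tendsto (fun t : ℝ => t ^ 2 + m) atTop atTop :=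
    tendsto_atTop_add_const_right _ _ (tendsto_pow_atTop two_ne_zero)
  have hlim : Tendsto (fun t : ℝ => 1 - m / (t ^ 2 + m)) atTop (𝓝 1) := by
    simpa using tendsto_const_nhds.sub (tendsto_const_nhds.div_atTop hden)
  refine tendsto_of_tendsto_of_tendsto_of_le_of_le' hlim tendsto_const_nhds ?_ ?_
  · filter_upwards [hden.eventually_gt_atTop 0, eventually_gt_atTop 0] with t ht ht0
    have hfrac : 1 - m / (t ^ 2 + m) = t * t / (t ^ 2 + m) := by field_simp; ring
    rw [hfrac, div_le_iff₀ ht]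
    linarith [mul_le_mul_of_nonneg_left (hlow t ht0) ht0.le]
  · filter_upwards [eventually_gt_atTop 0] with t ht using hup t ht

lemma tendsto_zero_of_tendsto_mul_atTop {g : ℝ → ℝ} {c : ℝ}
    (h : Tendsto (fun t => t * g t) atTop (𝓝 c)) : Tendsto g atTop (𝓝 0) := by
  have hmul : Tendsto (fun t : ℝ => t * g t * t⁻¹) atTop (𝓝 0) := by
    simpa using h.mul tendsto_inv_atTop_zero
  refine hmul.congr' ?_
  filter_upwards [eventually_gt_atTop 0] with t ht
  field_simp

lemma tendsto_one_of_sqrt_relation {s : ℝ} (hs : s ^ 2 < 1) {g A : ℝ → ℝ}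
    (hg : ∀ t, 0 < t → 0 < g t) (hA : ∀ t, 0 < t → 0 < A t)
    (h : ∀ t, 0 < t → g t ^ 2 * (A t ^ 2 - s ^ 2) = A t ^ 2 * (1 - A t ^ 2))
    (hg0 : Tendsto g atTop (𝓝 0)) : Tendsto A atTop (𝓝 1) := by
  have hlim : Tendsto (fun t => 1 - g t ^ 2) atTop (𝓝 1) := by
    simpa using tendsto_const_nhds.sub (hg0.pow 2)
  refine tendsto_of_tendsto_of_tendsto_of_le_of_le' hlim tendsto_const_nhds ?_ ?_ <;>
    filter_upwards [eventually_gt_atTop 0] with t ht <;>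
    have hlt := lt_one_of_sqrt_relation hs (hg t ht) (h t ht)
  · have := one_sub_sq_le_of_sqrt_relation (hA t ht) (h t ht)
    nlinarith [hA t ht]
  · exact hlt.le

lemma tendsto_mul_one_sub_div {s : ℝ} (hs : s ^ 2 < 1) {g A : ℝ → ℝ}
    (hg : ∀ t, 0 < t → 0 < g t) (hA : ∀ t, 0 < t → 0 < A t)
    (h : ∀ t, 0 < t → g t ^ 2 * (A t ^ 2 - s ^ 2) = A t ^ 2 * (1 - A t ^ 2))
    (htg : Tendsto (fun t => t * g t) atTop (𝓝 1)) :
    Tendsto (fun t => t * ((1 - A t) / (2 * g t))) atTop (𝓝 ((1 - s ^ 2) / 4)) := by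
  have hA1 := tendsto_one_of_sqrt_relation hs hg hA h (tendsto_zero_of_tendsto_mul_atTop htg)
  have hlim : Tendsto (fun t => t * g t * (1 - s ^ 2 / A t ^ 2) / (2 * (1 + A t))) atTop
      (𝓝 (1 * (1 - s ^ 2 / 1 ^ 2) / (2 * (1 + 1)))) :=
    (htg.mul (tendsto_const_nhds.sub (tendsto_const_nhds.div (hA1.pow 2) (by norm_num)))).div
      (tendsto_const_nhds.mul (tendsto_const_nhds.add hA1)) (by norm_num)
  rw [show 1 * (1 - s ^ 2 / 1 ^ 2) / (2 * (1 + 1)) = (1 - s ^ 2) / 4 by ring] at hlim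
  refine hlim.congr' ?_
  filter_upwards [eventually_gt_atTop 0] with t ht
  have := hg t ht
  have := hA t ht
  field_simp
  linear_combination h t ht

lemma div_lt_self_of_lt_variance {s V : ℝ} (hs : s ^ 2 < 1) {g A : ℝ → ℝ}
    (hgc : ContinuousOn g (Ioi 0)) (hAc : ContinuousOn A (Ioi 0))
    (hg : ∀ t, 0 < t → 0 < g t) (hA : ∀ t, 0 < t → 0 < A t)
    (h : ∀ t, 0 < t → g t ^ 2 * (A t ^ 2 - s ^ 2) = A t ^ 2 * (1 - A t ^ 2))
    (htg : Tendsto (fun t => t * g t) atTop (𝓝 1))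
    (hV : ∀ t, 0 < t → (t + (1 - A t) / (2 * g t)) *
      ((s / 2 * (1 - 1 / A t)) ^ 2 + ((1 + A t) / (2 * g t) - t) ^ 2) ≤
        V * ((1 + A t) / (2 * g t) - t))
    (hVs : V < (1 - s ^ 2) / 4) {t : ℝ} (ht : 0 < t) : A t / g t < t := by
  have hx : ∀ u, 0 < u → 0 < (1 - A u) / (2 * g u) := fun u hu =>
    div_pos (sub_pos.2 (lt_one_of_sqrt_relation hs (hg u hu) (h u hu)))
      (mul_pos two_pos (hg u hu))
  obtain ⟨T, hTV, hT⟩ : ∃ T, V < T * ((1 - A T) / (2 * g T)) ∧ 0 < T :=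
    (((tendsto_mul_one_sub_div hs hg hA h htg).eventually (lt_mem_nhds hVs)).and
      (eventually_gt_atTop 0)).exists
  have hlarge : A T / g T < T := by
    rw [← one_add_div_sub_one_sub_div]
    exact sub_lt_of_lt_mul hT (hx T hT) (hV T hT) hTV
  by_contra! hc
  have hcont : ContinuousOn (fun u => A u / g u - u) (Ioi 0) :=
    (hAc.div hgc fun u hu => (hg u hu).ne').sub continuousOn_id
  obtain ⟨u, hu, hu0⟩ := isPreconnected_Ioi.intermediate_value (mem_Ioi.2 hT) (mem_Ioi.2 ht)
    hcont (show (0 : ℝ) ∈ Icc _ _ from ⟨by linarith, by linarith⟩)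
  refine sub_ne_of_lt_variance (hx u hu)
    (mul_add_sq_eq_of_sqrt_relation (hg u hu) (hA u hu) (h u hu)) (hV u hu) hVs ?_
  rw [one_add_div_sub_one_sub_div]
  exact sub_eq_zero.1 hu0

lemma variance_le_of_subordination {s V m : ℝ} (hs0 : s ≠ 0) (hs : s ^ 2 < 1) (hV0 : 0 ≤ V)
    {g A : ℝ → ℝ} (hgc : ContinuousOn g (Ioi 0)) (hAc : ContinuousOn A (Ioi 0))
    (hg : ∀ t, 0 < t → 0 < g t) (hA : ∀ t, 0 < t → 0 < A t)
    (h : ∀ t, 0 < t → g t ^ 2 * (A t ^ 2 - s ^ 2) = A t ^ 2 * (1 - A t ^ 2))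
    (hlow : ∀ t, 0 < t → t ≤ (t ^ 2 + m) * g t) (hup : ∀ t, 0 < t → t * g t ≤ 1)
    (hV : ∀ t, 0 < t → (t + (1 - A t) / (2 * g t)) *
      ((s / 2 * (1 - 1 / A t)) ^ 2 + ((1 + A t) / (2 * g t) - t) ^ 2) ≤
        V * ((1 + A t) / (2 * g t) - t)) :
    (1 - s ^ 2) / 4 ≤ V := by
  by_contra! hVs
  -- At the height `t = s ^ 2` the inequality `A t / g t < t` is impossible.
  have ht : 0 < s ^ 2 := by positivity
  have hlt := div_lt_self_of_lt_variance hs hgc hAc hg hA h (tendsto_mul_atTop_one hlow hup) hV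
    hVs ht
  have hVt := hV _ ht
  have hσ := mul_add_sq_eq_of_sqrt_relation (hg _ ht) (hA _ ht) (h _ ht)
  have hA1 := lt_one_of_sqrt_relation hs (hg _ ht) (h _ ht)
  replace hg := hg _ ht
  replace hA := hA _ ht
  set G := g (s ^ 2)
  set B := A (s ^ 2)
  have hx : 0 < (1 - B) / (2 * G) := div_pos (by linarith) (by linarith)
  have hd : s / 2 * (1 - 1 / B) = -((1 - B) / (2 * G)) * (s * G / B) := by field_simp; ring
  have hd0 : s / 2 * (1 - 1 / B) ≠ 0 := by
    rw [hd]
    exact mul_ne_zero (neg_ne_zero.2 hx.ne') (by positivity)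
  have hdx : (s / 2 * (1 - 1 / B)) ^ 2 < ((1 - B) / (2 * G)) ^ 2 :=
    sq_lt_sq_of_lt_variance ht hx (by positivity) hd0 hV0 hσ hVt hVs
      (by rwa [one_add_div_sub_one_sub_div])
  have hGB : (s * G) ^ 2 < B ^ 2 := by
    rw [hd, mul_pow, neg_sq, mul_lt_iff_lt_one_right (by positivity), div_pow,
      div_lt_one (by positivity)] at hdx
    exact hdx
  have hBG : B ^ 2 < (s ^ 2 * G) ^ 2 := by
    rw [div_lt_iff₀ hg] at hlt
    gcongr
  have hGs : (s ^ 2 * G) ^ 2 ≤ (s * G) ^ 2 := by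
    calc (s ^ 2 * G) ^ 2 = s ^ 2 * (s * G) ^ 2 := by ring
      _ ≤ (s * G) ^ 2 := mul_le_of_le_one_left (sq_nonneg _) hs.le
  linarith

/-- The alternating product `x * y * x * ⋯` with `n` factors, starting with `x`. -/
def altProd {A : Type*} [Monoid A] : ℕ → A → A → A
  | 0, _, _ => 1
  | n + 1, x, y => x * altProd n y x

lemma altProd_succ {A : Type*} [Monoid A] (n : ℕ) (x y : A) :
    altProd (n + 1) x y = x * altProd n y x := rfl

lemma prod_ofFn_alternating {A : Type*} [Monoid A] (n : ℕ) (x y : A) :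
    (List.ofFn fun k : Fin n => if Even (k : ℕ) then x else y).prod = altProd n x y := by
  induction n generalizing x y with
  | zero => simp [altProd]
  | succ n ih => simp [List.ofFn_succ, altProd_succ, ← ih y x, Nat.even_add_one,
    -Nat.not_even_iff_odd, ite_not]

lemma mul_pow_eq_altProd {A : Type*} [Monoid A] (n : ℕ) (x y : A) :
    (x * y) ^ n = altProd (2 * n) x y := by
  induction n with
  | zero => simp [altProd]
  | succ n ih => rw [pow_succ', ih, mul_add, mul_one, altProd_succ, altProd_succ, mul_assoc]

lemma mul_pow_mul_eq_altProd {A : Type*} [Monoid A] (n : ℕ) (x y : A) :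
    (x * y) ^ n * x = altProd (2 * n + 1) x y := by
  rw [altProd_succ, ← mul_pow_eq_altProd, mul_pow_mul]

lemma FreelyIndependent.symm {A : Type*} [Ring A] [StarRing A] [Algebra ℂ A] [StarModule ℂ A]
    {φ : A →ₗ[ℂ] ℂ} {a b : A} (h : FreelyIndependent φ a b) : FreelyIndependent φ b a := by
  intro n i x hi hx h0
  refine h n (fun k => (i k).rev) x (fun k hk => hi k (Fin.rev_injective hk)) (fun k => ?_) h0
  have hmem := hx k
  revert hmem
  generalize i k = j
  fin_cases j <;> exact id

lemma hasSum_inverse_one_sub {A : Type*} [NormedRing A] [CompleteSpace A] {a : A} (h : ‖a‖ < 1) :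
    HasSum (fun n : ℕ => a ^ n) (Ring.inverse (1 - a)) := by
  rw [NormedRing.inverse_one_sub a h]
  exact (summable_geometric_of_norm_lt_one h).hasSum

section Banach

variable {A : Type*} [NormedRing A] [NormedAlgebra ℂ A] {φ : A →ₗ[ℂ] ℂ}

/-- `ζ ↦ φ (ζ (1 - ζ a)⁻¹)`, the Cauchy transform of `a` in the coordinate `ζ = 1 / z`, in which
the point at infinity becomes `0`. -/
noncomputable def momentTransform (φ : A →ₗ[ℂ] ℂ) (a : A) (ζ : ℂ) : ℂ :=
  ζ * φ (Ring.inverse (1 - ζ • a))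

@[simp] lemma momentTransform_zero (φ : A →ₗ[ℂ] ℂ) (a : A) : momentTransform φ a 0 = 0 := by
  simp [momentTransform]

lemma resolvent_inv (a : A) {ζ : ℂ} (hζ : ζ ≠ 0) :
    resolvent a ζ⁻¹ = ζ • Ring.inverse (1 - ζ • a) := by
  have h := spectrum.units_smul_resolvent_self (r := (Units.mk0 ζ hζ)⁻¹) (a := a)
  simp only [Units.smul_def, Units.val_inv_eq_inv_val, Units.val_mk0, inv_inv] at h
  rw [← inv_smul_eq_iff₀ hζ, h, resolvent, map_one]

lemma momentTransform_eq_map_resolvent (φ : A →ₗ[ℂ] ℂ) (a : A) {ζ : ℂ} (hζ : ζ ≠ 0) :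
    momentTransform φ a ζ = φ (resolvent a ζ⁻¹) := by
  rw [resolvent_inv a hζ, map_smul, smul_eq_mul, momentTransform]

lemma momentTransform_inv (φ : A →ₗ[ℂ] ℂ) (a : A) {z : ℂ} (hz : z ≠ 0) :
    momentTransform φ a z⁻¹ = φ (resolvent a z) := by
  rw [momentTransform_eq_map_resolvent φ a (inv_ne_zero hz), inv_inv]

lemma momentTransform_neg (φ : A →ₗ[ℂ] ℂ) (a : A) (ζ : ℂ) :
    momentTransform φ (-a) ζ = -momentTransform φ a (-ζ) := by
  simp [momentTransform]

lemma eventually_norm_smul_lt_one (a : A) : ∀ᶠ ζ : ℂ in 𝓝 0, ‖ζ • a‖ < 1 := by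
  have hlim : Tendsto (fun ζ : ℂ => ‖ζ • a‖) (𝓝 0) (𝓝 0) :=
    Continuous.tendsto' (by fun_prop) _ _ (by simp)
  exact hlim.eventually (gt_mem_nhds one_pos)

lemma analyticAt_linearMap (hφ : Continuous φ) (a : A) : AnalyticAt ℂ φ a :=
  (⟨φ, hφ⟩ : A →L[ℂ] ℂ).analyticAt a

variable [CompleteSpace A]

lemma eventually_hasSum_moments (hφ : Continuous φ) (a : A) : ∀ᶠ ζ : ℂ in 𝓝 0,
    HasSum (fun n : ℕ => ζ ^ n * φ (a ^ n)) (φ (Ring.inverse (1 - ζ • a))) := by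
  filter_upwards [eventually_norm_smul_lt_one a] with ζ hζ
  simpa [Function.comp_def, smul_pow] using (hasSum_inverse_one_sub hζ).map φ hφ

lemma analyticAt_inverse_one_sub_smul (a : A) :
    AnalyticAt ℂ (fun ζ : ℂ => Ring.inverse (1 - ζ • a)) 0 :=
  (spectrum.hasFPowerSeriesOnBall_inverse_one_sub_smul ℂ a).analyticAt

lemma hasStrictDerivAt_momentTransform (hφ : Continuous φ) (h1 : φ 1 = 1) (a : A) :
    HasStrictDerivAt (momentTransform φ a) 1 0 := by
  have h : AnalyticAt ℂ (fun ζ : ℂ => φ (Ring.inverse (1 - ζ • a))) 0 :=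
    (analyticAt_linearMap hφ _).comp (analyticAt_inverse_one_sub_smul a)
  have hmul := (hasStrictDerivAt_id (0 : ℂ)).mul h.hasStrictDerivAt
  simp only [id, one_mul, zero_mul, add_zero, zero_smul, sub_zero, Ring.inverse_one, h1] at hmul
  exact hmul

lemma tendsto_momentTransform_zero (hφ : Continuous φ) (h1 : φ 1 = 1) (a : A) :
    Tendsto (momentTransform φ a) (𝓝 0) (𝓝 0) := by
  simpa using (hasStrictDerivAt_momentTransform hφ h1 a).hasDerivAt.continuousAt.tendsto

/-- `L` is the compositional inverse near `0` of a function `h` with `h 0 = 0` and derivative `1`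
at `0`. For `h` the moment transform of `a`, the function `1 / L w` is the inverse of the Cauchy
transform, that is, `R w + 1 / w` for the `R`-transform of `a`. -/
structure IsLocalCompInverse (h L : ℂ → ℂ) : Prop where
  right : ∀ᶠ w in 𝓝 0, h (L w) = w
  left : ∀ᶠ ζ in 𝓝 0, L (h ζ) = ζ
  deriv : HasDerivAt L 1 0
  map_zero : L 0 = 0

lemma exists_isLocalCompInverse (hφ : Continuous φ) (h1 : φ 1 = 1) (a : A) :
    ∃ L, IsLocalCompInverse (momentTransform φ a) L := by
  have h := hasStrictDerivAt_momentTransform hφ h1 a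
  refine ⟨h.localInverse _ _ _ one_ne_zero, ?_, h.eventually_left_inverse one_ne_zero, ?_, ?_⟩
  · simpa using h.eventually_right_inverse one_ne_zero
  · simpa using (h.to_localInverse one_ne_zero).hasDerivAt
  · simpa using (h.eventually_left_inverse one_ne_zero).self_of_nhds

namespace IsLocalCompInverse

variable {h L : ℂ → ℂ}

lemma tendsto (H : IsLocalCompInverse h L) : Tendsto L (𝓝 0) (𝓝 0) := by
  simpa [H.map_zero] using H.deriv.continuousAt.tendsto

lemma tendsto_punctured (H : IsLocalCompInverse h L) (h0 : h 0 = 0) :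
    Tendsto L (𝓝[≠] 0) (𝓝[≠] 0) := by
  refine tendsto_nhdsWithin_iff.2 ⟨H.tendsto.mono_left nhdsWithin_le_nhds, ?_⟩
  filter_upwards [nhdsWithin_le_nhds H.right, self_mem_nhdsWithin] with w hw hw0 hL
  rw [hL, h0] at hw
  exact hw0 hw.symm

lemma tendsto_div (H : IsLocalCompInverse h L) :
    Tendsto (fun w => w * (L w)⁻¹) (𝓝[≠] 0) (𝓝 1) := by
  have hslope := (hasDerivAt_iff_tendsto_slope.1 H.deriv).inv₀ one_ne_zero
  simpa [slope_def_field, H.map_zero, div_eq_mul_inv] using hslope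

lemma eventually_eq (H : IsLocalCompInverse h L) {ι : Type*} {l : Filter ι} {M w : ι → ℂ}
    (hM : Tendsto M l (𝓝 0)) (hw : ∀ᶠ i in l, h (M i) = w i) : ∀ᶠ i in l, M i = L (w i) := by
  filter_upwards [hM.eventually H.left, hw] with i hleft hi
  rw [← hi, hleft]

lemma neg_comp_neg (H : IsLocalCompInverse h L) :
    IsLocalCompInverse (fun ζ => -h (-ζ)) fun w => -L (-w) where
  right := by
    filter_upwards [(continuous_neg.tendsto' (0 : ℂ) 0 neg_zero).eventually H.right] with w hw
    rw [neg_neg, hw, neg_neg]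
  left := by
    filter_upwards [(continuous_neg.tendsto' (0 : ℂ) 0 neg_zero).eventually H.left] with ζ hζ
    rw [neg_neg, hζ, neg_neg]
  deriv := by
    have hL : HasDerivAt L 1 (-0) := by simpa using H.deriv
    simpa [Function.comp_def] using! (hL.comp 0 (hasDerivAt_neg 0)).neg
  map_zero := by simp [H.map_zero]

lemma congr_left (H : IsLocalCompInverse h L) {k : ℂ → ℂ} (hk : h =ᶠ[𝓝 0] k) :
    IsLocalCompInverse k L where
  right := by
    filter_upwards [H.right, H.tendsto.eventually hk] with w hw hkw
    rw [← hkw, hw]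
  left := by
    filter_upwards [H.left, hk] with ζ hζ hkζ
    rw [← hkζ, hζ]
  deriv := H.deriv
  map_zero := H.map_zero

lemma eventually_odd (H : IsLocalCompInverse h L) (hh : Tendsto h (𝓝 0) (𝓝 0))
    (hL : ∀ᶠ w in 𝓝 0, L (-w) = -L w) : ∀ᶠ ζ in 𝓝 0, h (-ζ) = -h ζ := by
  have hneg : Tendsto (fun ζ => -h ζ) (𝓝 0) (𝓝 0) := by simpa using hh.neg
  filter_upwards [H.left, hh.eventually hL, hneg.eventually H.right] with ζ hleft hodd hright
  rw [hodd, hleft] at hright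
  exact hright

end IsLocalCompInverse

end Banach

section Free

lemma inverse_one_sub_smul_mem_closure_adjoin {A : Type*} [NormedRing A] [NormedAlgebra ℂ A]
    [StarRing A] [StarModule ℂ A] [CompleteSpace A] {a : A} {ζ : ℂ} (h : ‖ζ • a‖ < 1) :
    Ring.inverse (1 - ζ • a) ∈ closure (StarAlgebra.adjoin ℂ {a} : Set A) := by
  refine mem_closure_of_tendsto (hasSum_inverse_one_sub h).tendsto_sum_nat
    (Eventually.of_forall fun n => ?_)
  exact sum_mem fun k _ => pow_mem (SMulMemClass.smul_mem _
    (StarAlgebra.self_mem_adjoin_singleton ℂ a)) _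

-- With `P = z₁ - a` and `Q = z₂ - b`, the two hypotheses give `P + Q - w⁻¹ = w • P (1 - xy) Q`.
lemma resolvent_add_eq {A : Type*} [Ring A] [Algebra ℂ A] {a b x y : A} {z₁ z₂ w : ℂ}
    (hw : w ≠ 0) (ha : z₁ ∈ resolventSet ℂ a) (hb : z₂ ∈ resolventSet ℂ b)
    (hx : resolvent a z₁ = w • (1 + x)) (hy : resolvent b z₂ = w • (1 + y))
    (hxy : IsUnit (1 - x * y)) :
    resolvent (a + b) (z₁ + z₂ - w⁻¹) = w • ((1 + y) * Ring.inverse (1 - x * y) * (1 + x)) := by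
  have hPx := Ring.mul_inverse_cancel _ ha
  have hxP := Ring.inverse_mul_cancel _ ha
  have hQy := Ring.mul_inverse_cancel _ hb
  have hyQ := Ring.inverse_mul_cancel _ hb
  have hN := Ring.mul_inverse_cancel _ hxy
  have hN' := Ring.inverse_mul_cancel _ hxy
  rw [← resolvent, hx] at hPx hxP
  rw [← resolvent, hy] at hQy hyQ
  set P := algebraMap ℂ A z₁ - a with hP
  set Q := algebraMap ℂ A z₂ - b with hQ
  set N := Ring.inverse (1 - x * y)
  have hfactor : algebraMap ℂ A (z₁ + z₂ - w⁻¹) - (a + b) = w • (P * (1 - x * y) * Q) := by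
    have hexpand : w • (P * (1 - x * y) * Q) = P * ((w • (1 + y)) * Q) + (P * (w • (1 + x))) * Q
        - w⁻¹ • ((P * (w • (1 + x))) * ((w • (1 + y)) * Q)) := by
      simp only [mul_smul_comm, smul_mul_assoc, smul_smul]
      rw [← mul_assoc w⁻¹, inv_mul_cancel₀ hw, one_mul, ← smul_add, ← smul_sub]
      congr 1
      noncomm_ring
    rw [hexpand, hyQ, hPx, mul_one, one_mul, one_mul, hP, hQ, map_sub, map_add,
      Algebra.algebraMap_eq_smul_one w⁻¹]
    abel
  have hleft : (w • ((1 + y) * N * (1 + x))) * (w • (P * (1 - x * y) * Q)) = 1 := by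
    calc _ = (w • (1 + y)) * (N * (((w • (1 + x)) * P) * (1 - x * y))) * Q := by
          simp only [mul_smul_comm, smul_mul_assoc, mul_assoc]
      _ = 1 := by rw [hxP, one_mul, hN', mul_one, hyQ]
  have hright : (w • (P * (1 - x * y) * Q)) * (w • ((1 + y) * N * (1 + x))) = 1 := by
    calc _ = P * ((1 - x * y) * ((Q * (w • (1 + y))) * N)) * (w • (1 + x)) := by
          simp only [mul_smul_comm, smul_mul_assoc, mul_assoc]
      _ = 1 := by rw [hQy, one_mul, hN, mul_one, hPx]
  rw [resolvent, hfactor]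
  exact Ring.inverse_unit ⟨_, _, hright, hleft⟩

variable {A : Type*} [NormedRing A] [NormedAlgebra ℂ A] [StarRing A] [StarModule ℂ A]
  {φ : A →ₗ[ℂ] ℂ}

lemma FreeSubalgebras.map_prod_of_mem_closure (hφ : Continuous φ) (h1 : φ 1 = 1) {ι : Type*}
    {B : ι → StarSubalgebra ℂ A} (h : FreeSubalgebras φ B) {n : ℕ}
    {i : Fin (n + 1) → ι} {x : Fin (n + 1) → A} (hi : ∀ k : Fin n, i k.castSucc ≠ i k.succ)
    (hx : ∀ k, x k ∈ closure (B (i k) : Set A)) (h0 : ∀ k, φ (x k) = 0) :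
    φ (List.ofFn x).prod = 0 := by
  have hcentred : ∀ k, x k ∈ closure {y : A | y ∈ B (i k) ∧ φ y = 0} := by
    intro k
    have hc : Continuous fun y : A => y - φ y • (1 : A) := by fun_prop
    have hmaps : MapsTo (fun y : A => y - φ y • (1 : A)) (B (i k))
        {y : A | y ∈ B (i k) ∧ φ y = 0} := fun y hy =>
      ⟨sub_mem hy (SMulMemClass.smul_mem _ (one_mem _)), by simp [h1]⟩
    simpa [h0 k] using map_mem_closure hc (hx k) hmaps
  have hmem : x ∈ closure (Set.pi univ fun k => {y : A | y ∈ B (i k) ∧ φ y = 0}) := by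
    rw [closure_pi_set]
    exact fun k _ => hcentred k
  have hcont : Continuous fun x : Fin (n + 1) → A => φ (List.ofFn x).prod := by
    simp only [List.ofFn_eq_map]
    exact hφ.comp (continuous_list_prod _ fun k _ => continuous_apply k)
  refine closure_minimal (fun z hz => ?_) (isClosed_singleton.preimage hcont) hmem
  exact h n i z hi (fun k => (hz k trivial).1) (fun k => (hz k trivial).2)

lemma FreelyIndependent.map_altProd (hφ : Continuous φ) (h1 : φ 1 = 1) {a b x y : A}
    (h : FreelyIndependent φ a b) (hx : x ∈ closure (StarAlgebra.adjoin ℂ {a} : Set A))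
    (hy : y ∈ closure (StarAlgebra.adjoin ℂ {b} : Set A)) (hx0 : φ x = 0) (hy0 : φ y = 0)
    {n : ℕ} (hn : n ≠ 0) : φ (altProd n x y) = 0 := by
  obtain ⟨n, rfl⟩ := Nat.exists_eq_succ_of_ne_zero hn
  rw [Nat.succ_eq_add_one, ← prod_ofFn_alternating]
  refine FreeSubalgebras.map_prod_of_mem_closure hφ h1 h
    (i := fun k => if Even (k : ℕ) then 0 else 1) (fun k => ?_) (fun k => ?_) (fun k => ?_) <;>
    by_cases hk : Even (k : ℕ)
  · simp [Nat.even_add_one, hk]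
  · simp [Nat.even_add_one, hk]
  · rw [if_pos hk, if_pos hk]
    exact hx
  · rw [if_neg hk, if_neg hk]
    exact hy
  · simp [hk, hx0]
  · simp [hk, hy0]

variable [CompleteSpace A]

-- The Neumann series turns the left-hand side into `1` plus a sum of alternating words.
lemma FreelyIndependent.map_inverse_word (hφ : Continuous φ) (h1 : φ 1 = 1) {a b x y : A}
    (h : FreelyIndependent φ a b) (hx : x ∈ closure (StarAlgebra.adjoin ℂ {a} : Set A))
    (hy : y ∈ closure (StarAlgebra.adjoin ℂ {b} : Set A)) (hx0 : φ x = 0) (hy0 : φ y = 0)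
    (hxy : ‖x * y‖ < 1) : φ ((1 + y) * Ring.inverse (1 - x * y) * (1 + x)) = 1 := by
  have hsum := (((hasSum_inverse_one_sub hxy).mul_left (1 + y)).mul_right (1 + x)).map φ hφ
  refine hsum.unique ?_
  convert hasSum_ite_eq (0 : ℕ) (1 : ℂ) using 2 with n
  have hxy0 : ∀ m, m ≠ 0 → φ (altProd m x y) = 0 := fun m =>
    h.map_altProd hφ h1 hx hy hx0 hy0
  have hyx0 : ∀ m, m ≠ 0 → φ (altProd m y x) = 0 := fun m =>
    h.symm.map_altProd hφ h1 hy hx hy0 hx0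
  have hwords : (1 + y) * (x * y) ^ n * (1 + x) = altProd (2 * n) x y
      + altProd (2 * n + 1) x y + altProd (2 * n + 1) y x + altProd (2 * n + 2) y x := by
    rw [altProd_succ (2 * n) y x, altProd_succ (2 * n + 1) y x, ← mul_pow_eq_altProd,
      ← mul_pow_mul_eq_altProd]
    noncomm_ring
  simp only [Function.comp_apply, hwords, map_add, hxy0 (2 * n + 1) (by omega),
    hyx0 (2 * n + 1) (by omega), hyx0 (2 * n + 2) (by omega), add_zero]
  split_ifs with hn
  · simp [hn, altProd, h1]
  · exact hxy0 _ (by omega)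

lemma FreelyIndependent.map_resolvent_add (hφ : Continuous φ) (h1 : φ 1 = 1) {a b x y : A}
    (h : FreelyIndependent φ a b) {z₁ z₂ w : ℂ} (hw : w ≠ 0)
    (ha : z₁ ∈ resolventSet ℂ a) (hb : z₂ ∈ resolventSet ℂ b)
    (hxm : x ∈ closure (StarAlgebra.adjoin ℂ {a} : Set A))
    (hym : y ∈ closure (StarAlgebra.adjoin ℂ {b} : Set A)) (hx0 : φ x = 0) (hy0 : φ y = 0)
    (hx1 : ‖x‖ < 1) (hy1 : ‖y‖ < 1)
    (hx : resolvent a z₁ = w • (1 + x)) (hy : resolvent b z₂ = w • (1 + y)) :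
    φ (resolvent (a + b) (z₁ + z₂ - w⁻¹)) = w := by
  have hxy : ‖x * y‖ < 1 :=
    (norm_mul_le x y).trans_lt (mul_lt_one_of_nonneg_of_lt_one_left (norm_nonneg x) hx1 hy1.le)
  rw [resolvent_add_eq hw ha hb hx hy (isUnit_one_sub_of_norm_lt_one hxy), map_smul,
    h.map_inverse_word hφ h1 hxm hym hx0 hy0 hxy, smul_eq_mul, mul_one]

lemma eventually_exists_resolvent_inv_eq (hφ : Continuous φ) (h1 : φ 1 = 1) (a : A) :
    ∀ᶠ ζ : ℂ in 𝓝[≠] 0, ζ⁻¹ ∈ resolventSet ℂ a ∧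
      ∃ x ∈ closure (StarAlgebra.adjoin ℂ {a} : Set A), φ x = 0 ∧ ‖x‖ < 1 ∧
        resolvent a ζ⁻¹ = momentTransform φ a ζ • (1 + x) := by
  have hR : ContinuousAt (fun ζ : ℂ => Ring.inverse (1 - ζ • a)) 0 :=
    (analyticAt_inverse_one_sub_smul a).continuousAt
  have hφR : ContinuousAt (fun ζ : ℂ => φ (Ring.inverse (1 - ζ • a))) 0 :=
    hφ.continuousAt.comp hR
  have hφR0 : φ (Ring.inverse (1 - (0 : ℂ) • a)) ≠ 0 := by simp [h1]
  have hsmall : ∀ᶠ ζ : ℂ in 𝓝 0,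
      ‖(φ (Ring.inverse (1 - ζ • a)))⁻¹ • Ring.inverse (1 - ζ • a) - 1‖ < 1 :=
    (((hφR.inv₀ hφR0).smul hR).sub continuousAt_const).norm.tendsto.eventually
      (gt_mem_nhds (by simp [h1]))
  filter_upwards [nhdsWithin_le_nhds (eventually_norm_smul_lt_one a),
    nhdsWithin_le_nhds (hφR.eventually_ne hφR0), nhdsWithin_le_nhds hsmall, self_mem_nhdsWithin]
    with ζ hζa hne hlt hζ0
  replace hζ0 : ζ ≠ 0 := hζ0
  set R := Ring.inverse (1 - ζ • a) with hRdef
  refine ⟨?_, (φ R)⁻¹ • R - 1, ?_, by simp [h1, hne], hlt, ?_⟩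
  · have hfactor : algebraMap ℂ A ζ⁻¹ - a = ζ⁻¹ • (1 - ζ • a) := by
      rw [smul_sub, smul_smul, inv_mul_cancel₀ hζ0, one_smul, Algebra.algebraMap_eq_smul_one]
    rw [spectrum.mem_resolventSet_iff, hfactor]
    exact (isUnit_one_sub_of_norm_lt_one hζa).smul (Units.mk0 ζ hζ0)⁻¹
  · exact map_mem_closure (f := fun r : A => (φ R)⁻¹ • r - 1) (by fun_prop)
      (inverse_one_sub_smul_mem_closure_adjoin hζa)
      fun r hr => sub_mem (SMulMemClass.smul_mem _ hr) (one_mem _)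
  · rw [resolvent_inv a hζ0, momentTransform, ← hRdef, add_sub_cancel, smul_smul, mul_assoc,
      mul_inv_cancel₀ hne, mul_one]

lemma FreelyIndependent.eventually_map_resolvent_add (hφ : Continuous φ) (h1 : φ 1 = 1)
    {a b : A} (h : FreelyIndependent φ a b) {La Lb : ℂ → ℂ}
    (ha : IsLocalCompInverse (momentTransform φ a) La)
    (hb : IsLocalCompInverse (momentTransform φ b) Lb) :
    ∀ᶠ w in 𝓝[≠] 0, φ (resolvent (a + b) ((La w)⁻¹ + (Lb w)⁻¹ - w⁻¹)) = w := by
  filter_upwards [(ha.tendsto_punctured (momentTransform_zero φ a)).eventually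
      (eventually_exists_resolvent_inv_eq hφ h1 a),
    (hb.tendsto_punctured (momentTransform_zero φ b)).eventually
      (eventually_exists_resolvent_inv_eq hφ h1 b),
    nhdsWithin_le_nhds ha.right, nhdsWithin_le_nhds hb.right, self_mem_nhdsWithin]
    with w hRa hRb hwa hwb hw
  obtain ⟨hza, x, hxm, hx0, hx1, hx⟩ := hRa
  obtain ⟨hzb, y, hym, hy0, hy1, hy⟩ := hRb
  rw [hwa] at hx
  rw [hwb] at hy
  exact h.map_resolvent_add hφ h1 hw hza hzb hxm hym hx0 hy0 hx1 hy1 hx hy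

-- Additivity of the `R`-transform.
lemma FreelyIndependent.eventually_inv_add_inv (hφ : Continuous φ) (h1 : φ 1 = 1) {a b : A}
    (h : FreelyIndependent φ a b) {La Lb Lf : ℂ → ℂ}
    (ha : IsLocalCompInverse (momentTransform φ a) La)
    (hb : IsLocalCompInverse (momentTransform φ b) Lb)
    (hf : IsLocalCompInverse (momentTransform φ (a + b)) Lf) :
    ∀ᶠ w in 𝓝[≠] 0, (Lf w)⁻¹ = (La w)⁻¹ + (Lb w)⁻¹ - w⁻¹ := by
  have hlim : Tendsto (fun w => w * (La w)⁻¹ + w * (Lb w)⁻¹ - 1) (𝓝[≠] 0) (𝓝 1) := by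
    simpa using (ha.tendsto_div.add hb.tendsto_div).sub (tendsto_const_nhds (x := (1 : ℂ)))
  have hscale : ∀ᶠ w in 𝓝[≠] 0, w * (La w)⁻¹ + w * (Lb w)⁻¹ - 1 =
      w * ((La w)⁻¹ + (Lb w)⁻¹ - w⁻¹) := by
    filter_upwards [self_mem_nhdsWithin] with w hw
    rw [mul_sub, mul_add, mul_inv_cancel₀ hw]
  have hM : Tendsto (fun w => ((La w)⁻¹ + (Lb w)⁻¹ - w⁻¹)⁻¹) (𝓝[≠] 0) (𝓝 0) := by
    have hmul : Tendsto (fun w : ℂ => w * (w * (La w)⁻¹ + w * (Lb w)⁻¹ - 1)⁻¹) (𝓝[≠] 0)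
        (𝓝 (0 * 1⁻¹)) := (tendsto_id.mono_left nhdsWithin_le_nhds).mul (hlim.inv₀ one_ne_zero)
    rw [zero_mul] at hmul
    refine hmul.congr' ?_
    filter_upwards [hscale, self_mem_nhdsWithin] with w hsw hw
    rw [hsw, mul_inv, mul_inv_cancel_left₀ hw]
  have hinv : ∀ᶠ w in 𝓝[≠] 0,
      momentTransform φ (a + b) ((La w)⁻¹ + (Lb w)⁻¹ - w⁻¹)⁻¹ = w := by
    filter_upwards [h.eventually_map_resolvent_add hφ h1 ha hb, hscale,
      hlim.eventually_ne one_ne_zero] with w hres hsw hne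
    rwa [momentTransform_inv _ _ (right_ne_zero_of_mul (hsw ▸ hne))]
  filter_upwards [hf.eventually_eq hM hinv] with w hw
  rw [← hw, inv_inv]

end Free

section Symmetry

lemma coeff_eq_zero_of_eventually_hasSum_zero {c : ℕ → ℂ}
    (h : ∀ᶠ z : ℂ in 𝓝 0, HasSum (fun n => z ^ n * c n) 0) (n : ℕ) : c n = 0 := by
  have hp : HasFPowerSeriesAt (0 : ℂ → ℂ) (FormalMultilinearSeries.ofScalars ℂ c) 0 := by
    rw [hasFPowerSeriesAt_iff]
    filter_upwards [h] with z hz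
    simpa using hz
  rw [← FormalMultilinearSeries.coeff_ofScalars (𝕜 := ℂ) (p := c) (n := n), hp.eq_zero]
  rfl

variable {A : Type*} [NormedRing A] [NormedAlgebra ℂ A] [CompleteSpace A] {φ : A →ₗ[ℂ] ℂ}

lemma eventually_momentTransform_odd (hφ : Continuous φ) {a : A}
    (h : ∀ k : ℕ, φ (a ^ (2 * k + 1)) = 0) :
    ∀ᶠ ζ in 𝓝 0, momentTransform φ a (-ζ) = -momentTransform φ a ζ := by
  filter_upwards [eventually_hasSum_moments hφ a, (continuous_neg.tendsto' (0 : ℂ) 0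
    neg_zero).eventually (eventually_hasSum_moments hφ a)] with ζ hζ hnegζ
  have heven : (fun n : ℕ => (-ζ) ^ n * φ (a ^ n)) = fun n => ζ ^ n * φ (a ^ n) := by
    funext n
    rcases Nat.even_or_odd' n with ⟨k, rfl | rfl⟩
    · rw [(even_two_mul k).neg_pow]
    · rw [h k, mul_zero, mul_zero]
  rw [heven] at hnegζ
  rw [momentTransform, momentTransform, hnegζ.unique hζ, neg_mul]

lemma map_odd_pow_of_momentTransform_odd (hφ : Continuous φ) {a : A}
    (h : ∀ᶠ ζ in 𝓝 0, momentTransform φ a (-ζ) = -momentTransform φ a ζ) (k : ℕ) :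
    φ (a ^ (2 * k + 1)) = 0 := by
  have hodd : ∀ᶠ z : ℂ in 𝓝 0, HasSum (fun n => z ^ n * ((1 - (-1) ^ n) * φ (a ^ n))) 0 := by
    filter_upwards [eventually_hasSum_moments hφ a, (continuous_neg.tendsto' (0 : ℂ) 0
      neg_zero).eventually (eventually_hasSum_moments hφ a), h] with ζ hζ hnegζ hoddζ
    have hsub : φ (Ring.inverse (1 - ζ • a)) - φ (Ring.inverse (1 - (-ζ) • a)) = 0 := by
      by_cases hζ0 : ζ = 0
      · simp [hζ0]
      · rw [momentTransform, momentTransform, neg_mul, neg_inj] at hoddζ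
        rw [mul_left_cancel₀ hζ0 hoddζ, sub_self]
    rw [← hsub]
    refine (hζ.sub hnegζ).congr_fun fun n => ?_
    rw [neg_pow ζ n]
    ring
  have hcoeff := coeff_eq_zero_of_eventually_hasSum_zero hodd (2 * k + 1)
  rw [(odd_two_mul_add_one k).neg_one_pow] at hcoeff
  exact (mul_eq_zero.1 hcoeff).resolve_left (by norm_num)

lemma SameDistribution.eventuallyEq_momentTransform (hφ : Continuous φ) {a b : A}
    (h : SameDistribution φ a b) : momentTransform φ a =ᶠ[𝓝 0] momentTransform φ b := by
  filter_upwards [eventually_hasSum_moments hφ a, eventually_hasSum_moments hφ b] with ζ ha hb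
  simp only [h _] at ha
  rw [momentTransform, momentTransform, ha.unique hb]

lemma FreelyIndependent.map_odd_pow_add [StarRing A] [StarModule ℂ A] (hφ : Continuous φ)
    (h1 : φ 1 = 1) {a b : A} (h : FreelyIndependent φ a b) (hd : SameDistribution φ b (-a))
    (k : ℕ) : φ ((a + b) ^ (2 * k + 1)) = 0 := by
  obtain ⟨La, ha⟩ := exists_isLocalCompInverse hφ h1 a
  obtain ⟨Lf, hf⟩ := exists_isLocalCompInverse hφ h1 (a + b)
  have hb : IsLocalCompInverse (momentTransform φ b) fun w => -La (-w) := by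
    refine ha.neg_comp_neg.congr_left ?_
    filter_upwards [hd.eventuallyEq_momentTransform hφ] with ζ hζ
    rw [hζ, momentTransform_neg]
  have hneg : Tendsto (fun w : ℂ => -w) (𝓝[≠] 0) (𝓝[≠] 0) :=
    tendsto_nhdsWithin_iff.2 ⟨(continuous_neg.tendsto' (0 : ℂ) 0 neg_zero).mono_left
      nhdsWithin_le_nhds, eventually_mem_nhdsWithin.mono fun _ => neg_ne_zero.2⟩
  have hadd := h.eventually_inv_add_inv hφ h1 ha hb hf
  have hodd : ∀ᶠ w in 𝓝[≠] 0, Lf (-w) = -Lf w := by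
    filter_upwards [hadd, hneg.eventually hadd] with w hw hnegw
    rw [← inv_inj, inv_neg, hw, hnegw]
    simp only [inv_neg, neg_neg]
    ring
  refine map_odd_pow_of_momentTransform_odd hφ
    (hf.eventually_odd (tendsto_momentTransform_zero hφ h1 (a + b)) ?_) k
  filter_upwards [eventually_nhdsWithin_iff.1 hodd] with w hw
  rcases eq_or_ne w 0 with rfl | hw0
  · simp [hf.map_zero]
  · exact hw hw0

end Symmetry

section State

open scoped ComplexOrder

/-- States: unital positive linear functionals. -/
structure IsState {A : Type*} [Ring A] [StarRing A] [Algebra ℂ A] (φ : A →ₗ[ℂ] ℂ) : Prop where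
  map_one : φ 1 = 1
  nonneg : ∀ a, 0 ≤ φ (star a * a)

lemma IsNormalTracialState.isState {H : Type*} [NormedAddCommGroup H] [InnerProductSpace ℂ H]
    [CompleteSpace H] {M : VonNeumannAlgebra H} {φ : M.toStarSubalgebra →ₗ[ℂ] ℂ}
    (h : IsNormalTracialState M φ) : IsState φ :=
  ⟨h.map_one, fun a => Complex.nonneg_iff.2 ⟨h.re_nonneg a, (h.im_eq_zero a).symm⟩⟩

variable {A : Type*} [CStarAlgebra A] {φ : A →ₗ[ℂ] ℂ}

lemma IsState.map_nonneg [PartialOrder A] [StarOrderedRing A] (h : IsState φ) {a : A}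
    (ha : 0 ≤ a) : 0 ≤ φ a := by
  obtain ⟨b, rfl⟩ := CStarAlgebra.nonneg_iff_eq_star_mul_self.1 ha
  exact h.nonneg b

lemma IsState.continuous (h : IsState φ) : Continuous φ := by
  let _ := CStarAlgebra.spectralOrder A
  have := CStarAlgebra.spectralOrderedRing A
  exact map_continuous (PositiveLinearMap.mk₀ φ fun _ => h.map_nonneg)

lemma IsState.map_star (h : IsState φ) (a : A) : φ (star a) = star (φ a) := by
  let _ := CStarAlgebra.spectralOrder A
  have := CStarAlgebra.spectralOrderedRing A
  exact StarHomClass.map_star (PositiveLinearMap.mk₀ φ fun _ => h.map_nonneg) a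

lemma IsState.norm_map_star_mul_sq_le (h : IsState φ) (a b : A) :
    ‖φ (star a * b)‖ ^ 2 ≤ (φ (star a * a)).re * (φ (star b * b)).re := by
  let _ := CStarAlgebra.spectralOrder A
  have := CStarAlgebra.spectralOrderedRing A
  let f := PositiveLinearMap.mk₀ φ fun _ => h.map_nonneg
  have norm_sq (c : A) : ‖f.toPreGNS c‖ ^ 2 = (φ (star c * c)).re := by
    exact_mod_cast congrArg Complex.re (f.preGNS_norm_sq (f.toPreGNS c))
  rw [← norm_sq, ← norm_sq, ← mul_pow]
  gcongr
  exact norm_inner_le_norm (𝕜 := ℂ) (f.toPreGNS a) (f.toPreGNS b)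

lemma IsState.map_star_sub_mul_sub (h : IsState φ) (a b : A) :
    φ (star (a - φ a • 1) * (b - φ b • 1)) = φ (star a * b) - star (φ a) * φ b := by
  simp only [star_sub, star_smul, star_one, sub_mul, mul_sub, smul_mul_assoc, mul_smul_comm,
    one_mul, mul_one, map_sub, map_smul, smul_eq_mul, h.map_star, h.map_one]
  ring

lemma IsState.re_map_star_sub_mul_sub_self (h : IsState φ) (a : A) :
    (φ (star (a - φ a • 1) * (a - φ a • 1))).re = (φ (star a * a)).re - ‖φ a‖ ^ 2 := by
  rw [h.map_star_sub_mul_sub, Complex.sub_re, Complex.star_def, Complex.conj_mul',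
    ← Complex.ofReal_pow, Complex.ofReal_re]

lemma IsState.norm_covariance_sq_le (h : IsState φ) (a b : A) :
    ‖φ (star a * b) - star (φ a) * φ b‖ ^ 2 ≤
      ((φ (star a * a)).re - ‖φ a‖ ^ 2) * ((φ (star b * b)).re - ‖φ b‖ ^ 2) := by
  rw [← h.map_star_sub_mul_sub, ← h.re_map_star_sub_mul_sub_self,
    ← h.re_map_star_sub_mul_sub_self]
  exact h.norm_map_star_mul_sq_le _ _

lemma IsState.norm_map_sq_le (h : IsState φ) (a : A) : ‖φ a‖ ^ 2 ≤ (φ (star a * a)).re := by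
  simpa [h.map_one] using h.norm_map_star_mul_sq_le 1 a

section Resolvent

variable {y : A} {ω : ℂ}

lemma isUnit_algebraMap_sub_of_isSelfAdjoint (hy : IsSelfAdjoint y) (hω : ω.im ≠ 0) :
    IsUnit (algebraMap ℂ A ω - y) :=
  of_not_not fun h => hω (hy.im_eq_zero_of_mem_spectrum h)

lemma star_resolvent_of_isSelfAdjoint (hy : IsSelfAdjoint y) (ω : ℂ) :
    star (resolvent y ω) = resolvent y (star ω) := by
  rw [resolvent, resolvent, ← Ring.inverse_star, star_sub, hy.star_eq, algebraMap_star_comm]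

lemma mul_resolvent_of_isSelfAdjoint (hy : IsSelfAdjoint y) (hω : ω.im ≠ 0) :
    y * resolvent y ω = ω • resolvent y ω - 1 := by
  have h := Ring.mul_inverse_cancel _ (isUnit_algebraMap_sub_of_isSelfAdjoint hy hω)
  rw [← resolvent, sub_mul, ← Algebra.smul_def] at h
  rw [← h, sub_sub_cancel]

lemma analyticAt_map_resolvent_of_isSelfAdjoint (hφ : Continuous φ) (hy : IsSelfAdjoint y)
    (hω : ω.im ≠ 0) : AnalyticAt ℂ (fun z => φ (resolvent y z)) ω := by
  let ψ : A →L[ℂ] ℂ := ⟨φ, hφ⟩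
  have hd : DifferentiableOn ℂ (fun z => ψ (resolvent y z)) (resolventSet ℂ y) := fun z hz =>
    (ψ.differentiableAt.comp z
      (spectrum.hasDerivAt_resolvent_const_left hz).differentiableAt).differentiableWithinAt
  exact hd.analyticAt ((spectrum.isOpen_resolventSet y).mem_nhds
    (isUnit_algebraMap_sub_of_isSelfAdjoint hy hω))

lemma sub_star_smul_star_resolvent_mul_resolvent (hy : IsSelfAdjoint y) (hω : ω.im ≠ 0) :
    (ω - star ω) • (star (resolvent y ω) * resolvent y ω) =
      star (resolvent y ω) - resolvent y ω := by
  have h := mul_resolvent_of_isSelfAdjoint hy hω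
  have h' : star (resolvent y ω) * y = star ω • star (resolvent y ω) - 1 := by
    simpa [hy.star_eq] using congrArg star h
  have hassoc := mul_assoc (star (resolvent y ω)) y (resolvent y ω)
  rw [h, h', sub_mul, mul_sub, one_mul, mul_one, smul_mul_assoc, mul_smul_comm] at hassoc
  rw [sub_eq_sub_iff_add_eq_add] at hassoc
  rw [sub_smul, sub_eq_sub_iff_add_eq_add, ← hassoc, add_comm]

lemma IsState.re_map_star_resolvent_mul_resolvent (h : IsState φ) (hy : IsSelfAdjoint y)
    (hω : ω.im ≠ 0) :
    (φ (star (resolvent y ω) * resolvent y ω)).re = -(φ (resolvent y ω)).im / ω.im := by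
  have key := congrArg (fun a => (φ a).im) (sub_star_smul_star_resolvent_mul_resolvent hy hω)
  simp only [map_smul, map_sub, h.map_star, smul_eq_mul, Complex.star_def, Complex.sub_im,
    Complex.mul_im, Complex.sub_re, Complex.conj_re, Complex.conj_im] at key
  rw [eq_div_iff hω]
  linarith

lemma IsState.norm_one_sub_mul_map_resolvent_sq_le (h : IsState φ) (hy : IsSelfAdjoint y)
    (hω : ω.im ≠ 0) :
    ‖1 - (ω - φ y) * φ (resolvent y ω)‖ ^ 2 ≤ ((φ (y ^ 2)).re - ‖φ y‖ ^ 2) *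
      (-(φ (resolvent y ω)).im / ω.im - ‖φ (resolvent y ω)‖ ^ 2) := by
  have hcs := h.norm_covariance_sq_le y (resolvent y ω)
  rw [h.re_map_star_resolvent_mul_resolvent hy hω, ← h.map_star, hy.star_eq,
    mul_resolvent_of_isSelfAdjoint hy hω, map_sub, map_smul, h.map_one, smul_eq_mul, ← pow_two,
    ← norm_neg] at hcs
  rwa [show 1 - (ω - φ y) * φ (resolvent y ω) =
    -(ω * φ (resolvent y ω) - 1 - φ y * φ (resolvent y ω)) by ring]

end Resolvent

end State

section Projection

open Complex (I)

/-- A square root of the discriminant of the quadratic equation satisfied by the value `w` of the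
Cauchy transform of a projection of trace `(1 + s) / 2`. -/
noncomputable def projSqrt (s w : ℂ) : ℂ := (1 + 2 * s * w + w ^ 2) ^ (2⁻¹ : ℂ)

/-- The point at which the Cauchy transform of a projection of trace `(1 + s) / 2` takes the
value `w`. -/
noncomputable def projInvCauchy (s w : ℂ) : ℂ := (w + 1 + projSqrt s w) / (2 * w)

/-- The subordination point of an element free from a projection of trace `(1 + s) / 2`, in terms
of the value `w` of the Cauchy transform of their sum at `z`. -/
noncomputable def projSubordination (s z w : ℂ) : ℂ := z + w⁻¹ - projInvCauchy s w

lemma projSqrt_sq (s w : ℂ) : projSqrt s w ^ 2 = 1 + 2 * s * w + w ^ 2 := by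
  simpa only [projSqrt, Nat.cast_ofNat] using
    Complex.cpow_nat_inv_pow (1 + 2 * s * w + w ^ 2) (n := 2) two_ne_zero

@[simp] lemma projSqrt_zero (s : ℂ) : projSqrt s 0 = 1 := by simp [projSqrt]

lemma analyticAt_projSqrt {s w : ℂ} (h : 1 + 2 * s * w + w ^ 2 ∈ Complex.slitPlane) :
    AnalyticAt ℂ (projSqrt s) w :=
  AnalyticAt.cpow (by fun_prop) analyticAt_const h

lemma mul_projInvCauchy (s : ℂ) {w : ℂ} (hw : w ≠ 0) :
    2 * w * projInvCauchy s w = w + 1 + projSqrt s w :=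
  mul_div_cancel₀ _ (mul_ne_zero two_ne_zero hw)

lemma projInvCauchy_quadratic (s : ℂ) {w : ℂ} (hw : w ≠ 0) :
    w * projInvCauchy s w * (projInvCauchy s w - 1) = projInvCauchy s w - (1 - s) / 2 := by
  have hS : projSqrt s w = 2 * w * projInvCauchy s w - w - 1 := by
    rw [mul_projInvCauchy s hw]; ring
  have hsq := projSqrt_sq s w
  rw [hS] at hsq
  exact mul_left_cancel₀ hw (by linear_combination hsq / 4)

lemma resolvent_of_isIdempotentElem {A : Type*} [Ring A] [Algebra ℂ A] {e : A}
    (he : IsIdempotentElem e) {ω : ℂ} (h0 : ω ≠ 0) (h1 : ω ≠ 1) :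
    resolvent e ω = ω⁻¹ • (1 - e) + (ω - 1)⁻¹ • e := by
  have hdecomp : algebraMap ℂ A ω - e = ω • (1 - e) + (ω - 1) • e := by
    rw [Algebra.algebraMap_eq_smul_one, smul_sub, sub_smul, one_smul, sub_add_sub_cancel]
  have hmul (α β γ δ : ℂ) : (α • (1 - e) + β • e) * (γ • (1 - e) + δ • e) =
      (α * γ) • (1 - e) + (β * δ) • e := by
    simp only [add_mul, mul_add, smul_mul_smul_comm, he.one_sub.eq, he.eq, he.one_sub_mul_self,
      he.mul_one_sub_self, smul_zero, add_zero, zero_add]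
  rw [resolvent, hdecomp]
  refine Ring.inverse_unit ⟨_, _, ?_, ?_⟩ <;>
    simp only [hmul, mul_inv_cancel₀ h0, mul_inv_cancel₀ (sub_ne_zero.2 h1), inv_mul_cancel₀ h0,
      inv_mul_cancel₀ (sub_ne_zero.2 h1), one_smul, sub_add_cancel]

lemma map_resolvent_projInvCauchy {A : Type*} [Ring A] [Algebra ℂ A] {φ : A →ₗ[ℂ] ℂ}
    (hφ1 : φ 1 = 1) {e : A} (he : IsIdempotentElem e) {s w : ℂ} (hs : φ e = (1 + s) / 2)
    (hw : w ≠ 0) (h0 : projInvCauchy s w ≠ 0) (h1 : projInvCauchy s w ≠ 1) :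
    φ (resolvent e (projInvCauchy s w)) = w := by
  have hquad := projInvCauchy_quadratic s hw
  have h1' := sub_ne_zero.2 h1
  rw [resolvent_of_isIdempotentElem he h0 h1]
  simp only [map_add, map_smul, map_sub, hφ1, hs, smul_eq_mul]
  field_simp
  linear_combination -2 * hquad

lemma tendsto_inv_projInvCauchy (s : ℂ) :
    Tendsto (fun w => (projInvCauchy s w)⁻¹) (𝓝[≠] 0) (𝓝[≠] 0) := by
  have hden : Tendsto (fun w => w + 1 + projSqrt s w) (𝓝 0) (𝓝 2) := by
    have hS : Tendsto (projSqrt s) (𝓝 0) (𝓝 1) := by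
      simpa using (analyticAt_projSqrt (s := s) (w := 0) (by simp)).continuousAt.tendsto
    simpa [one_add_one_eq_two] using (tendsto_id.add_const (1 : ℂ)).add hS
  simp only [projInvCauchy, inv_div]
  refine tendsto_nhdsWithin_iff.2 ⟨Tendsto.mono_left ?_ nhdsWithin_le_nhds, ?_⟩
  · simpa [Pi.div_def] using (tendsto_id.const_mul (2 : ℂ)).div hden two_ne_zero
  · filter_upwards [self_mem_nhdsWithin,
      nhdsWithin_le_nhds (hden.eventually_ne two_ne_zero)] with w hw hne
    exact div_ne_zero (mul_ne_zero two_ne_zero hw) hne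

section Subordination

variable {A : Type*} [NormedRing A] [NormedAlgebra ℂ A] {φ : A →ₗ[ℂ] ℂ}

lemma eventually_eq_inv_projInvCauchy (hφ1 : φ 1 = 1) {e : A} (he : IsIdempotentElem e) {s : ℂ}
    (hs : φ e = (1 + s) / 2) {L : ℂ → ℂ} (hL : IsLocalCompInverse (momentTransform φ e) L) :
    ∀ᶠ w in 𝓝[≠] 0, (projInvCauchy s w)⁻¹ = L w := by
  have hlim := tendsto_inv_projInvCauchy s
  refine hL.eventually_eq (hlim.mono_right nhdsWithin_le_nhds) ?_
  filter_upwards [self_mem_nhdsWithin, hlim.eventually self_mem_nhdsWithin,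
    (hlim.mono_right nhdsWithin_le_nhds).eventually_ne zero_ne_one] with w hw h0 h1
  have h0' : projInvCauchy s w ≠ 0 := mt inv_eq_zero.2 h0
  rw [momentTransform_inv _ _ h0']
  exact map_resolvent_projInvCauchy hφ1 he hs hw h0' (mt inv_eq_one.2 h1)

lemma FreelyIndependent.eventually_map_resolvent_projSubordination [CompleteSpace A]
    [StarRing A] [StarModule ℂ A] (hφ : Continuous φ) (hφ1 : φ 1 = 1) {e y : A}
    (h : FreelyIndependent φ e y)
    (he : IsIdempotentElem e) {s : ℂ} (hs : φ e = (1 + s) / 2) :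
    ∀ᶠ ζ in 𝓝[≠] 0, φ (resolvent y (projSubordination s ζ⁻¹ (momentTransform φ (e + y) ζ))) =
      momentTransform φ (e + y) ζ := by
  obtain ⟨Le, hLe⟩ := exists_isLocalCompInverse hφ hφ1 e
  obtain ⟨Ly, hLy⟩ := exists_isLocalCompInverse hφ hφ1 y
  obtain ⟨Lf, hLf⟩ := exists_isLocalCompInverse hφ hφ1 (e + y)
  have hlim : Tendsto (momentTransform φ (e + y)) (𝓝[≠] 0) (𝓝[≠] 0) := by
    simpa using (hasStrictDerivAt_momentTransform hφ hφ1 (e + y)).hasDerivAt.tendsto_nhdsNE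
      one_ne_zero
  filter_upwards [nhdsWithin_le_nhds hLf.left,
    hlim.eventually (h.eventually_inv_add_inv hφ hφ1 hLe hLy hLf),
    hlim.eventually (eventually_eq_inv_projInvCauchy hφ1 he hs hLe),
    hlim.eventually (nhdsWithin_le_nhds hLy.right),
    hlim.eventually ((hLy.tendsto_punctured (momentTransform_zero φ y)).eventually
      self_mem_nhdsWithin)] with ζ hleft hadd heq hright hne
  have hsub : projSubordination s ζ⁻¹ (momentTransform φ (e + y) ζ) =
      (Ly (momentTransform φ (e + y) ζ))⁻¹ := by
    rw [hleft, ← heq, inv_inv] at hadd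
    rw [projSubordination, hadd]
    ring
  rw [hsub, ← momentTransform_eq_map_resolvent _ _ hne, hright]

end Subordination

section ImaginaryAxis

variable {s g : ℝ}

lemma mem_slitPlane_of_imaginary (hs : s ≠ 0) (hg : 0 < g) :
    1 + 2 * s * -(I * g) + (-(I * g)) ^ 2 ∈ Complex.slitPlane := by
  refine Complex.mem_slitPlane_iff.2 (Or.inr ?_)
  simp [pow_two, hs, hg.ne']

lemma projSqrt_re_pos (hs : s ≠ 0) (hg : 0 < g) : 0 < (projSqrt s (-(I * g))).re := by
  have him := (Complex.abs_re_lt_norm (z := 1 + 2 * s * -(I * g) + (-(I * g)) ^ 2)).2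
    (by simp [pow_two, hs, hg.ne'])
  rw [projSqrt, Complex.cpow_inv_two_re]
  refine Real.sqrt_pos.2 (div_pos ?_ two_pos)
  linarith [(abs_lt.1 him).1]

lemma projSqrt_neg_I_mul_sq (s g : ℝ) :
    projSqrt s (-(I * g)) ^ 2 = ⟨1 - g ^ 2, -(2 * s * g)⟩ := by
  rw [projSqrt_sq, Complex.mk_eq_add_mul_I]
  push_cast
  linear_combination (g : ℂ) ^ 2 * Complex.I_sq

lemma projSqrt_re_mul_im (s g : ℝ) :
    (projSqrt s (-(I * g))).re * (projSqrt s (-(I * g))).im = -(s * g) := by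
  have h : (projSqrt s (-(I * g)) ^ 2).im = -(2 * s * g) := by
    rw [projSqrt_neg_I_mul_sq]
  rw [pow_two, Complex.mul_im] at h
  linarith

lemma projSqrt_re_sq_sub_im_sq (s g : ℝ) :
    (projSqrt s (-(I * g))).re ^ 2 - (projSqrt s (-(I * g))).im ^ 2 = 1 - g ^ 2 := by
  have h : (projSqrt s (-(I * g)) ^ 2).re = 1 - g ^ 2 := by
    rw [projSqrt_neg_I_mul_sq]
  rw [pow_two, Complex.mul_re] at h
  linarith

lemma projSqrt_re_relation (s g : ℝ) :
    g ^ 2 * ((projSqrt s (-(I * g))).re ^ 2 - s ^ 2) =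
      (projSqrt s (-(I * g))).re ^ 2 * (1 - (projSqrt s (-(I * g))).re ^ 2) := by
  have h := projSqrt_re_mul_im s g
  have h' := projSqrt_re_sq_sub_im_sq s g
  set S := projSqrt s (-(I * g))
  linear_combination (S.re * S.im - s * g) * h + S.re ^ 2 * h'

lemma projSubordination_neg_I_mul (s t : ℝ) (hg : 0 < g) :
    projSubordination s (I * t) (-(I * g)) =
      ⟨(projSqrt s (-(I * g))).im / (2 * g) - 1 / 2,
        t + (1 - (projSqrt s (-(I * g))).re) / (2 * g)⟩ := by
  have hg' : (g : ℂ) ≠ 0 := by exact_mod_cast hg.ne'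
  have hI := Complex.I_ne_zero
  rw [projSubordination, projInvCauchy, Complex.mk_eq_add_mul_I]
  nth_rw 1 [← Complex.re_add_im (projSqrt s (-(I * g)))]
  set S := projSqrt s (-(I * g))
  push_cast
  field_simp
  linear_combination (S.re - 1 : ℂ) * Complex.I_sq

lemma projSubordination_im (s t : ℝ) (hg : 0 < g) :
    (projSubordination s (I * t) (-(I * g))).im =
      t + (1 - (projSqrt s (-(I * g))).re) / (2 * g) := by
  rw [projSubordination_neg_I_mul s t hg]

lemma projSubordination_re (hs : s ≠ 0) (t : ℝ) (hg : 0 < g) :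
    (projSubordination s (I * t) (-(I * g))).re =
      s / 2 * (1 - 1 / (projSqrt s (-(I * g))).re) - (1 + s) / 2 := by
  have hre := projSqrt_re_pos hs hg
  simp only [projSubordination_neg_I_mul s t hg]
  field_simp
  linear_combination projSqrt_re_mul_im s g

lemma projSubordination_im_pos (hs : s ^ 2 < 1) {t : ℝ} (ht : 0 < t) (hg : 0 < g) :
    0 < (projSubordination s (I * t) (-(I * g))).im := by
  have hlt := lt_one_of_sqrt_relation hs hg (projSqrt_re_relation s g)
  rw [projSubordination_im s t hg]
  have : 0 < (1 - (projSqrt s (-(I * g))).re) / (2 * g) := div_pos (by linarith) (by linarith)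
  positivity

lemma analyticAt_neg_I_mul {g : ℝ → ℝ} {t : ℝ} (hg : AnalyticAt ℝ g t) :
    AnalyticAt ℝ (fun t => -(I * (g t : ℂ))) t :=
  (analyticAt_const.mul ((Complex.ofRealCLM.analyticAt _).comp hg)).neg

lemma analyticAt_projSqrt_imaginary (hs : s ≠ 0) {g : ℝ → ℝ} {t : ℝ} (hg : AnalyticAt ℝ g t)
    (hpos : 0 < g t) : AnalyticAt ℝ (fun t => projSqrt s (-(I * g t))) t :=
  AnalyticAt.comp (f := fun t => -(I * (g t : ℂ)))
    (analyticAt_projSqrt (mem_slitPlane_of_imaginary hs hpos)).restrictScalars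
    (analyticAt_neg_I_mul hg)

lemma analyticAt_I_mul (t : ℝ) : AnalyticAt ℝ (fun t : ℝ => I * (t : ℂ)) t :=
  analyticAt_const.mul (Complex.ofRealCLM.analyticAt t)

lemma analyticAt_projSubordination_imaginary (hs : s ≠ 0) {g : ℝ → ℝ} {t : ℝ}
    (hg : AnalyticAt ℝ g t) (hpos : 0 < g t) :
    AnalyticAt ℝ (fun t : ℝ => projSubordination s (I * t) (-(I * g t))) t := by
  have hw := analyticAt_neg_I_mul hg
  have hw0 : -(I * (g t : ℂ)) ≠ 0 :=
    neg_ne_zero.2 (mul_ne_zero Complex.I_ne_zero (by exact_mod_cast hpos.ne'))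
  exact ((analyticAt_I_mul t).add (hw.inv hw0)).sub
    (((hw.add analyticAt_const).add (analyticAt_projSqrt_imaginary hs hg hpos)).div
      (analyticAt_const.mul hw) (mul_ne_zero two_ne_zero hw0))

lemma tendsto_inv_I_mul_atTop : Tendsto (fun t : ℝ => (I * (t : ℂ))⁻¹) atTop (𝓝[≠] 0) := by
  refine tendsto_nhdsWithin_iff.2 ⟨?_, ?_⟩
  · rw [tendsto_zero_iff_norm_tendsto_zero]
    simpa [Function.comp_def] using tendsto_inv_atTop_zero.comp tendsto_abs_atTop_atTop
  · filter_upwards [eventually_gt_atTop 0] with t ht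
    simpa using ht.ne'

end ImaginaryAxis

end Projection

section LowerBound

open Complex (I)

variable {A : Type*} [CStarAlgebra A] {φ : A →ₗ[ℂ] ℂ} {f y : A} {t : ℝ}

/-- Minus the imaginary part of the Cauchy transform of `f` at the point `i t` of the imaginary
axis. If the distribution of `f` is symmetric, it determines the Cauchy transform there. -/
noncomputable def negImCauchy (φ : A →ₗ[ℂ] ℂ) (f : A) (t : ℝ) : ℝ :=
  -(φ (resolvent f (I * t))).im

lemma im_I_mul_ne_zero (ht : 0 < t) : (I * (t : ℂ)).im ≠ 0 := by simpa using ht.ne'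

lemma analyticAt_negImCauchy (hφ : Continuous φ) (hf : IsSelfAdjoint f) (ht : 0 < t) :
    AnalyticAt ℝ (negImCauchy φ f) t := by
  have hres : AnalyticAt ℝ (fun t : ℝ => φ (resolvent f (I * t))) t :=
    AnalyticAt.comp (f := fun t : ℝ => I * (t : ℂ))
      (analyticAt_map_resolvent_of_isSelfAdjoint hφ hf (im_I_mul_ne_zero ht)).restrictScalars
      (analyticAt_I_mul t)
  exact ((Complex.imCLM.analyticAt _).comp hres).neg

lemma IsState.re_map_star_resolvent_I_mul (h : IsState φ) (hf : IsSelfAdjoint f) (ht : 0 < t) :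
    (φ (star (resolvent f (I * t)) * resolvent f (I * t))).re = negImCauchy φ f t / t := by
  rw [h.re_map_star_resolvent_mul_resolvent hf (im_I_mul_ne_zero ht), negImCauchy, Complex.I_mul_im,
    Complex.ofReal_re]

lemma algebraMap_sub_mul_star_self (hf : IsSelfAdjoint f) (t : ℝ) :
    (algebraMap ℂ A (I * t) - f) * star (algebraMap ℂ A (I * t) - f) =
      algebraMap ℂ A (t ^ 2 : ℝ) + f ^ 2 := by
  have hstar : star (I * (t : ℂ)) = -(I * t) := by simp
  have hsq : ((t ^ 2 : ℝ) : ℂ) = -(I * (t : ℂ)) ^ 2 := by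
    push_cast
    linear_combination (t : ℂ) ^ 2 * Complex.I_sq
  have hcomm : Commute (algebraMap ℂ A (I * t)) f := Algebra.commutes _ _
  rw [star_sub, ← algebraMap_star_comm, hstar, hf.star_eq, hsq, map_neg, map_neg, map_pow,
    ← sub_eq_zero]
  simp only [sub_mul, mul_sub, mul_neg, pow_two, hcomm.eq]
  abel

lemma IsState.le_mul_negImCauchy (h : IsState φ) (hf : IsSelfAdjoint f) (ht : 0 < t) :
    t ≤ (t ^ 2 + (φ (f ^ 2)).re) * negImCauchy φ f t := by
  have hcs := h.norm_map_star_mul_sq_le (star (algebraMap ℂ A (I * t) - f)) (resolvent f (I * t))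
  rw [star_star, algebraMap_sub_mul_star_self hf, resolvent,
    Ring.mul_inverse_cancel _ (isUnit_algebraMap_sub_of_isSelfAdjoint hf (im_I_mul_ne_zero ht)),
    ← resolvent, h.re_map_star_resolvent_I_mul hf ht, map_add, h.map_one, norm_one, one_pow,
    Algebra.algebraMap_eq_smul_one, map_smul, h.map_one, smul_eq_mul, mul_one, Complex.add_re,
    Complex.ofReal_re, mul_div_assoc', le_div_iff₀ ht, one_mul] at hcs
  exact hcs

lemma IsState.norm_map_sq_le_re (h : IsState φ) (hf : IsSelfAdjoint f) :
    ‖φ f‖ ^ 2 ≤ (φ (f ^ 2)).re := by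
  simpa only [hf.star_eq, ← pow_two] using h.norm_map_sq_le f

lemma IsState.negImCauchy_pos (h : IsState φ) (hf : IsSelfAdjoint f) (ht : 0 < t) :
    0 < negImCauchy φ f t := by
  have := (sq_nonneg _).trans (h.norm_map_sq_le_re hf)
  exact pos_of_mul_pos_right (ht.trans_le (h.le_mul_negImCauchy hf ht)) (by positivity)

lemma IsState.mul_negImCauchy_le_one (h : IsState φ) (hf : IsSelfAdjoint f) (ht : 0 < t) :
    t * negImCauchy φ f t ≤ 1 := by
  have hg := h.negImCauchy_pos hf ht
  have hnorm : negImCauchy φ f t ≤ ‖φ (resolvent f (I * t))‖ :=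
    (neg_le_abs _).trans (Complex.abs_im_le_norm _)
  have hsq : negImCauchy φ f t ^ 2 ≤ negImCauchy φ f t / t := by
    rw [← h.re_map_star_resolvent_I_mul hf ht]
    exact (pow_le_pow_left₀ hg.le hnorm 2).trans (h.norm_map_sq_le _)
  rw [le_div_iff₀ ht, pow_two, mul_assoc] at hsq
  rw [mul_comm]
  exact (mul_le_iff_le_one_right hg).1 hsq

lemma IsState.eventually_map_resolvent_I_mul (h : IsState φ) (hf : IsSelfAdjoint f)
    (hodd : ∀ k : ℕ, φ (f ^ (2 * k + 1)) = 0) :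
    ∀ᶠ t : ℝ in atTop, φ (resolvent f (I * t)) = -(I * negImCauchy φ f t) := by
  filter_upwards [(tendsto_inv_I_mul_atTop.mono_right nhdsWithin_le_nhds).eventually
    (eventually_momentTransform_odd h.continuous hodd), eventually_gt_atTop 0] with t ht_odd ht
  have hz : I * (t : ℂ) ≠ 0 := mul_ne_zero Complex.I_ne_zero (by exact_mod_cast ht.ne')
  have hstar : -(I * (t : ℂ)) = star (I * (t : ℂ)) := by simp
  rw [← inv_neg, momentTransform_inv _ _ (neg_ne_zero.2 hz), momentTransform_inv _ _ hz, hstar,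
    ← star_resolvent_of_isSelfAdjoint hf, h.map_star, Complex.star_def] at ht_odd
  have hre : (φ (resolvent f (I * t))).re = 0 := by
    have := congrArg Complex.re ht_odd
    rw [Complex.conj_re, Complex.neg_re] at this
    linarith
  apply Complex.ext <;> simp [hre, negImCauchy]

lemma IsState.eventually_map_resolvent_projSubordination (h : IsState φ) {e : A}
    (he : IsStarProjection e) (hy : IsSelfAdjoint y) {s : ℝ} (hs : φ e = (1 + s) / 2)
    (hfree : FreelyIndependent φ e y) (hodd : ∀ k : ℕ, φ ((e + y) ^ (2 * k + 1)) = 0) :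
    ∀ᶠ t : ℝ in atTop,
      φ (resolvent y (projSubordination s (I * t) (-(I * negImCauchy φ (e + y) t)))) =
        -(I * negImCauchy φ (e + y) t) := by
  filter_upwards [tendsto_inv_I_mul_atTop.eventually
      (hfree.eventually_map_resolvent_projSubordination h.continuous h.map_one
        he.isIdempotentElem hs),
    h.eventually_map_resolvent_I_mul (he.isSelfAdjoint.add hy) hodd,
    eventually_gt_atTop 0] with t hsub him ht
  have hz : I * (t : ℂ) ≠ 0 := mul_ne_zero Complex.I_ne_zero (by exact_mod_cast ht.ne')
  rwa [momentTransform_inv _ _ hz, inv_inv, him] at hsub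

lemma IsState.map_resolvent_projSubordination (h : IsState φ) {e : A}
    (he : IsStarProjection e) (hy : IsSelfAdjoint y) {s : ℝ} (hs : φ e = (1 + s) / 2)
    (hs0 : s ≠ 0) (hs1 : s ^ 2 < 1) (hfree : FreelyIndependent φ e y)
    (hodd : ∀ k : ℕ, φ ((e + y) ^ (2 * k + 1)) = 0) (ht : 0 < t) :
    φ (resolvent y (projSubordination s (I * t) (-(I * negImCauchy φ (e + y) t)))) =
      -(I * negImCauchy φ (e + y) t) := by
  have hf : IsSelfAdjoint (e + y) := he.isSelfAdjoint.add hy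
  obtain ⟨T, hT⟩ := eventually_atTop.1
    (h.eventually_map_resolvent_projSubordination he hy hs hfree hodd)
  have hleft : AnalyticOnNhd ℝ (fun t : ℝ => φ (resolvent y (projSubordination s (I * t)
      (-(I * negImCauchy φ (e + y) t))))) (Ioi 0) := fun t ht =>
    AnalyticAt.comp (f := fun t : ℝ => projSubordination s (I * t)
        (-(I * negImCauchy φ (e + y) t)))
      (analyticAt_map_resolvent_of_isSelfAdjoint h.continuous hy
        (projSubordination_im_pos hs1 ht (h.negImCauchy_pos hf ht)).ne').restrictScalars
      (analyticAt_projSubordination_imaginary hs0 (analyticAt_negImCauchy h.continuous hf ht)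
        (h.negImCauchy_pos hf ht))
  have hright : AnalyticOnNhd ℝ (fun t : ℝ => -(I * (negImCauchy φ (e + y) t : ℂ))) (Ioi 0) :=
    fun t ht => analyticAt_neg_I_mul (analyticAt_negImCauchy h.continuous hf ht)
  have hmem : max T 0 + 1 ∈ Ioi (0 : ℝ) := (le_max_right T 0).trans_lt (lt_add_one _)
  refine hleft.eqOn_of_preconnected_of_eventuallyEq hright isPreconnected_Ioi hmem ?_ ht
  filter_upwards [lt_mem_nhds ((le_max_left T 0).trans_lt (lt_add_one _))] with t ht
  exact hT t ht.le

lemma IsState.im_mul_le_variance_mul (h : IsState φ) (hy : IsSelfAdjoint y) {m g : ℝ}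
    (hm : φ y = m) {ω : ℂ} (hω : 0 < ω.im) (hg : 0 < g) (hG : φ (resolvent y ω) = -(I * g)) :
    ω.im * ((ω.re - m) ^ 2 + (1 / g - ω.im) ^ 2) ≤
      ((φ (y ^ 2)).re - m ^ 2) * (1 / g - ω.im) := by
  have hcs := h.norm_one_sub_mul_map_resolvent_sq_le hy hω.ne'
  have hleft : ‖1 - (ω - m) * -(I * g)‖ ^ 2 = (1 - g * ω.im) ^ 2 + (g * (ω.re - m)) ^ 2 := by
    rw [← Complex.normSq_eq_norm_sq, Complex.normSq_apply]
    simp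
    ring
  have him : -(-(I * (g : ℂ))).im = g := by simp
  have hnorm : ‖-(I * (g : ℂ))‖ ^ 2 = g ^ 2 := by simp
  rw [hG, hm, hleft, him, hnorm, Complex.norm_real, Real.norm_eq_abs, sq_abs] at hcs
  calc ω.im * ((ω.re - m) ^ 2 + (1 / g - ω.im) ^ 2)
      = ω.im / g ^ 2 * ((1 - g * ω.im) ^ 2 + (g * (ω.re - m)) ^ 2) := by field_simp; ring
    _ ≤ ω.im / g ^ 2 * (((φ (y ^ 2)).re - m ^ 2) * (g / ω.im - g ^ 2)) := by gcongr
    _ = ((φ (y ^ 2)).re - m ^ 2) * (1 / g - ω.im) := by field_simp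

lemma map_eq_neg_of_symmetric {e : A} (hodd : ∀ k : ℕ, φ ((e + y) ^ (2 * k + 1)) = 0) :
    φ y = -φ e := by
  have hmean := hodd 0
  rw [mul_zero, zero_add, pow_one, map_add] at hmean
  exact eq_neg_of_add_eq_zero_right hmean

lemma IsState.variance_le_of_symmetric (h : IsState φ) {e : A} (he : IsStarProjection e)
    (hy : IsSelfAdjoint y) {s : ℝ} (hs : φ e = (1 + s) / 2) (hs0 : s ≠ 0) (hs1 : s ^ 2 < 1)
    (hfree : FreelyIndependent φ e y) (hodd : ∀ k : ℕ, φ ((e + y) ^ (2 * k + 1)) = 0) :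
    (1 - s ^ 2) / 4 ≤ (φ (y ^ 2)).re - ((1 + s) / 2) ^ 2 := by
  have hf : IsSelfAdjoint (e + y) := he.isSelfAdjoint.add hy
  have hmean : φ y = (-((1 + s) / 2) : ℝ) := by
    rw [map_eq_neg_of_symmetric hodd, hs]
    push_cast
    rfl
  have hvar : 0 ≤ (φ (y ^ 2)).re - ((1 + s) / 2) ^ 2 := by
    have := h.norm_map_sq_le_re hy
    rw [hmean, Complex.norm_real, Real.norm_eq_abs, sq_abs, neg_sq] at this
    exact sub_nonneg.2 this
  have hg : ∀ t, 0 < t → 0 < negImCauchy φ (e + y) t := fun t ht => h.negImCauchy_pos hf ht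
  have hganal : ∀ t, 0 < t → AnalyticAt ℝ (negImCauchy φ (e + y)) t := fun t ht =>
    analyticAt_negImCauchy h.continuous hf ht
  refine variance_le_of_subordination hs0 hs1 hvar
    (g := negImCauchy φ (e + y)) (A := fun t => (projSqrt s (-(I * negImCauchy φ (e + y) t))).re)
    (m := (φ ((e + y) ^ 2)).re)
    (fun t ht => (hganal t ht).continuousAt.continuousWithinAt)
    (fun t ht => (Complex.continuous_re.continuousAt.comp (analyticAt_projSqrt_imaginary hs0
      (hganal t ht) (hg t ht)).continuousAt).continuousWithinAt)
    hg (fun t ht => projSqrt_re_pos hs0 (hg t ht)) (fun t _ => projSqrt_re_relation s _)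
    (fun t ht => h.le_mul_negImCauchy hf ht) (fun t ht => h.mul_negImCauchy_le_one hf ht)
    fun t ht => ?_
  have hcs := h.im_mul_le_variance_mul hy hmean (projSubordination_im_pos hs1 ht (hg t ht))
    (hg t ht) (h.map_resolvent_projSubordination he hy hs hs0 hs1 hfree hodd ht)
  have hdiff : ∀ A g : ℝ, g ≠ 0 →
      1 / g - (t + (1 - A) / (2 * g)) = (1 + A) / (2 * g) - t := fun A g hg => by
    field_simp
    ring
  rwa [projSubordination_re hs0 t (hg t ht), projSubordination_im s t (hg t ht),
    hdiff _ _ (hg t ht).ne', sub_neg_eq_add, sub_add_cancel, neg_sq] at hcs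

theorem IsState.le_re_map_sq_of_mem_freeSymmetrizers (h : IsState φ) {e : A}
    (he : IsStarProjection e) {p : ℝ} (hpe : φ e = p) (hp_half : p ≠ 1 / 2)
    (hy : y ∈ freeSymmetrizers φ e) : p ≤ (φ (y ^ 2)).re := by
  obtain ⟨hy, hfree, hodd⟩ := hy
  have hp : p ^ 2 ≤ p := by
    simpa [hpe, pow_two e, he.isIdempotentElem.eq] using h.norm_map_sq_le_re he.isSelfAdjoint
  rcases hp.eq_or_lt with hp | hp
  · calc p = ‖φ y‖ ^ 2 := by simp [map_eq_neg_of_symmetric hodd, hpe, hp]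
      _ ≤ (φ (y ^ 2)).re := h.norm_map_sq_le_re hy
  · have hs : φ e = (1 + (2 * p - 1 : ℝ)) / 2 := by
      rw [hpe]
      push_cast
      ring
    have hvar := h.variance_le_of_symmetric he hy hs (by contrapose! hp_half; linarith)
      (by linarith) hfree hodd
    linarith

end LowerBound

section VonNeumann

variable {H : Type*} [NormedAddCommGroup H] [InnerProductSpace ℂ H] [CompleteSpace H]

lemma isClosed_coe_vonNeumannAlgebra (M : VonNeumannAlgebra H) :
    IsClosed (M.toStarSubalgebra : Set (H →L[ℂ] H)) := by
  rw [VonNeumannAlgebra.coe_toStarSubalgebra, ← M.centralizer_centralizer]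
  exact Set.isClosed_centralizer _

/-- The commutant of `s ∪ star s`, as a von Neumann algebra; the star-closure is needed because
`s` is an arbitrary set of operators. -/
noncomputable def commutantOfSet (s : Set (H →L[ℂ] H)) : VonNeumannAlgebra H where
  toStarSubalgebra := StarSubalgebra.centralizer ℂ s
  centralizer_centralizer' := Set.centralizer_centralizer_centralizer _

lemma mem_commutantOfSet {s : Set (H →L[ℂ] H)} (hs : ∀ x ∈ s, IsSelfAdjoint x) {a : H →L[ℂ] H} :
    a ∈ (commutantOfSet s).toStarSubalgebra ↔ ∀ x ∈ s, Commute x a := by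
  refine (StarSubalgebra.mem_centralizer_iff ℂ).trans (forall₂_congr fun x hx => ?_)
  rw [(hs x hx).star_eq]
  exact and_self_iff

/-- The vector functional `a ↦ ⟪ξ, a ξ⟫`. -/
noncomputable def vectorFunctional (M : VonNeumannAlgebra H) (ξ : H) :
    M.toStarSubalgebra →ₗ[ℂ] ℂ where
  toFun a := inner ℂ ξ ((a : H →L[ℂ] H) ξ)
  map_add' a b := by simp
  map_smul' c a := by simp

lemma vectorFunctional_apply (M : VonNeumannAlgebra H) (ξ : H) (a : M.toStarSubalgebra) :
    vectorFunctional M ξ a = inner ℂ ξ ((a : H →L[ℂ] H) ξ) := rfl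

lemma vectorFunctional_star_mul (M : VonNeumannAlgebra H) (ξ : H) (a b : M.toStarSubalgebra) :
    vectorFunctional M ξ (star a * b) = inner ℂ ((a : H →L[ℂ] H) ξ) ((b : H →L[ℂ] H) ξ) :=
  ContinuousLinearMap.adjoint_inner_right (a : H →L[ℂ] H) ξ ((b : H →L[ℂ] H) ξ)

lemma vectorFunctional_star_mul_self (M : VonNeumannAlgebra H) (ξ : H) (a : M.toStarSubalgebra) :
    vectorFunctional M ξ (star a * a) = (‖(a : H →L[ℂ] H) ξ‖ ^ 2 : ℝ) := by
  rw [vectorFunctional_star_mul, inner_self_eq_norm_sq_to_K]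
  exact (Complex.ofReal_pow _ _).symm

lemma isNormalFunctional_vectorFunctional (M : VonNeumannAlgebra H) (ξ : H) :
    IsNormalFunctional M (vectorFunctional M ξ) := by
  have hs : Summable fun n : ℕ => ‖(Pi.single 0 ξ : ℕ → H) n‖ ^ 2 :=
    summable_of_ne_finset_zero (s := {0}) fun n hn => by
      rw [Pi.single_eq_of_ne (by simpa using hn), norm_zero, zero_pow two_ne_zero]
  refine ⟨Pi.single 0 ξ, Pi.single 0 ξ, hs, hs, fun a => ?_⟩
  convert hasSum_single (0 : ℕ) fun n hn => ?_ using 1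
  · rw [Pi.single_eq_same, vectorFunctional_apply]
  · rw [Pi.single_eq_of_ne hn, inner_zero_left]

lemma isNormalTracialState_vectorFunctional {M : VonNeumannAlgebra H} {ξ : H} (hξ : ‖ξ‖ = 1)
    (htr : ∀ a b, vectorFunctional M ξ (a * b) = vectorFunctional M ξ (b * a)) :
    IsNormalTracialState M (vectorFunctional M ξ) where
  map_one := by
    have h := vectorFunctional_star_mul_self M ξ 1
    rw [star_one, one_mul] at h
    rw [h, OneMemClass.coe_one, one_apply_eq_self, hξ, one_pow, Complex.ofReal_one]
  re_nonneg a := by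
    rw [vectorFunctional_star_mul_self, Complex.ofReal_re]
    positivity
  im_eq_zero a := by rw [vectorFunctional_star_mul_self, Complex.ofReal_im]
  tracial := htr
  normal := isNormalFunctional_vectorFunctional M ξ

lemma isFaithfulFunctional_vectorFunctional {M : VonNeumannAlgebra H} {ξ : H}
    (h : ∀ a : M.toStarSubalgebra, (a : H →L[ℂ] H) ξ = 0 → a = 0) :
    IsFaithfulFunctional (vectorFunctional M ξ) := by
  intro a ha
  rw [vectorFunctional_star_mul_self, Complex.ofReal_eq_zero, sq_eq_zero_iff, norm_eq_zero] at ha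
  exact h a ha

end VonNeumann

lemma sameDistribution_neg_of_isIdempotentElem {A : Type*} [Ring A] [Algebra ℂ A]
    {φ : A →ₗ[ℂ] ℂ} {a b : A} (ha : IsIdempotentElem a) (hb : IsIdempotentElem b)
    (h : φ a = φ b) : SameDistribution φ (-a) (-b) := by
  have hpow : ∀ c : A, IsIdempotentElem c → ∀ n : ℕ,
      φ ((-c) ^ (n + 1)) = (-1) ^ (n + 1) * φ c := fun c hc n => by
    rw [← neg_one_smul ℂ c, smul_pow, hc.pow_succ_eq, map_smul, smul_eq_mul]
  rintro (_ | n)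
  · rw [pow_zero, pow_zero]
  · rw [hpow a ha, hpow b hb, h]

section StarProjection

variable {A : Type*} [Ring A] [StarRing A] [Algebra ℂ A] [StarModule ℂ A] {φ : A →ₗ[ℂ] ℂ}

lemma adjoin_singleton_neg (a : A) : StarAlgebra.adjoin ℂ {-a} = StarAlgebra.adjoin ℂ {a} := by
  have hle : ∀ b : A, StarAlgebra.adjoin ℂ {-b} ≤ StarAlgebra.adjoin ℂ {b} := fun b =>
    StarAlgebra.adjoin_le (singleton_subset_iff.2
      (neg_mem (StarAlgebra.self_mem_adjoin_singleton ℂ b)))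
  exact (hle a).antisymm (by simpa using hle (-a))

lemma FreelyIndependent.neg_right {a b : A} (h : FreelyIndependent φ a b) :
    FreelyIndependent φ a (-b) := by
  rwa [FreelyIndependent, adjoin_singleton_neg]

lemma exists_eq_smul_one_add_smul_of_mem_adjoin {q x : A} (hq : IsStarProjection q)
    (hx : x ∈ StarAlgebra.adjoin ℂ {q}) : ∃ α β : ℂ, x = α • 1 + β • q := by
  induction hx using StarAlgebra.adjoin_induction with
  | mem x hx => exact ⟨0, 1, by simp [mem_singleton_iff.1 hx]⟩
  | algebraMap r => exact ⟨r, 0, by simp [Algebra.algebraMap_eq_smul_one]⟩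
  | add x y _ _ hx hy =>
    obtain ⟨α, β, rfl⟩ := hx
    obtain ⟨γ, δ, rfl⟩ := hy
    exact ⟨α + γ, β + δ, by module⟩
  | mul x y _ _ hx hy =>
    obtain ⟨α, β, rfl⟩ := hx
    obtain ⟨γ, δ, rfl⟩ := hy
    refine ⟨α * γ, α * δ + β * γ + β * δ, ?_⟩
    simp only [add_mul, mul_add, smul_mul_smul_comm, one_mul, mul_one, hq.isIdempotentElem.eq]
    module
  | star x _ hx =>
    obtain ⟨α, β, rfl⟩ := hx
    exact ⟨star α, star β, by simp [hq.isSelfAdjoint.star_eq]⟩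

lemma exists_eq_smul_sub_of_mem_adjoin (h1 : φ 1 = 1) {q x : A} (hq : IsStarProjection q)
    (hx : x ∈ StarAlgebra.adjoin ℂ {q}) (hx0 : φ x = 0) : ∃ β : ℂ, x = β • (q - φ q • 1) := by
  obtain ⟨α, β, rfl⟩ := exists_eq_smul_one_add_smul_of_mem_adjoin hq hx
  rw [map_add, map_smul, map_smul, h1, smul_eq_mul, smul_eq_mul, mul_one] at hx0
  refine ⟨β, ?_⟩
  rw [eq_neg_of_add_eq_zero_left hx0]
  module

end StarProjection

section SequenceSpace

open scoped lp

variable {ι : Type*}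

lemma memℓp_comp_perm (σ : Equiv.Perm ι) (f : ℓ²(ι, ℂ)) : Memℓp (f ∘ σ) 2 :=
  memℓp_gen ((Equiv.summable_iff σ (f := fun i => ‖f i‖ ^ (2 : ENNReal).toReal)).2
    ((lp.memℓp f).summable (by norm_num)))

/-- Composition with a permutation of the index set. -/
noncomputable def permOp (σ : Equiv.Perm ι) : ℓ²(ι, ℂ) →L[ℂ] ℓ²(ι, ℂ) :=
  LinearMap.mkContinuous
    { toFun := fun f => ⟨f ∘ σ, memℓp_comp_perm σ f⟩
      map_add' := fun _ _ => rfl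
      map_smul' := fun _ _ => rfl } 1 fun f => by
    rw [one_mul, lp.norm_eq_tsum_rpow (by norm_num), lp.norm_eq_tsum_rpow (by norm_num)]
    exact le_of_eq (congrArg (· ^ _) (Equiv.tsum_eq σ fun i => ‖f i‖ ^ (2 : ENNReal).toReal))

lemma permOp_apply (σ : Equiv.Perm ι) (f : ℓ²(ι, ℂ)) (n : ι) : permOp σ f n = f (σ n) := rfl

/-- The coordinate projection onto a set of indices. -/
noncomputable def coordProj (D : Set ι) : ℓ²(ι, ℂ) →L[ℂ] ℓ²(ι, ℂ) :=
  LinearMap.mkContinuous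
    { toFun := fun f => ⟨D.indicator f, (lp.memℓp f).mono' fun n => norm_indicator_le_norm_self f n⟩
      map_add' := fun f g => lp.ext (Set.indicator_add D f g)
      map_smul' := fun c f => lp.ext (Set.indicator_const_smul D c f) } 1 fun f => by
    rw [one_mul]
    exact lp.norm_mono two_ne_zero fun n => norm_indicator_le_norm_self f n

lemma coordProj_apply (D : Set ι) (f : ℓ²(ι, ℂ)) (n : ι) : coordProj D f n = D.indicator f n := rfl

/-- The operator by which a generator of a Hecke algebra acts on `ℓ²` of a Coxeter group, where
`σ` is the multiplication by the generator and `D` is the set of elements it shortens. -/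
noncomputable def heckeOp (σ : Equiv.Perm ι) (D : Set ι) (c : ℝ) : ℓ²(ι, ℂ) →L[ℂ] ℓ²(ι, ℂ) :=
  permOp σ + (c : ℂ) • coordProj D

lemma heckeOp_apply (σ : Equiv.Perm ι) (D : Set ι) (c : ℝ) (f : ℓ²(ι, ℂ)) (n : ι) :
    heckeOp σ D c f n = f (σ n) + c * D.indicator f n := rfl

lemma isSelfAdjoint_permOp {σ : Equiv.Perm ι} (hσ : Function.Involutive σ) :
    IsSelfAdjoint (permOp σ) := by
  refine ContinuousLinearMap.isSelfAdjoint_iff_isSymmetric.2 fun f g => ?_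
  change inner ℂ (permOp σ f) g = inner ℂ f (permOp σ g)
  rw [lp.inner_eq_tsum, lp.inner_eq_tsum, ← Equiv.tsum_eq σ]
  simp only [permOp_apply, hσ _]

lemma isSelfAdjoint_coordProj (D : Set ι) : IsSelfAdjoint (coordProj D) := by
  refine ContinuousLinearMap.isSelfAdjoint_iff_isSymmetric.2 fun f g => ?_
  change inner ℂ (coordProj D f) g = inner ℂ f (coordProj D g)
  rw [lp.inner_eq_tsum, lp.inner_eq_tsum]
  refine tsum_congr fun n => ?_
  by_cases h : n ∈ D <;> simp [coordProj_apply, h]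

lemma isSelfAdjoint_heckeOp {σ : Equiv.Perm ι} (hσ : Function.Involutive σ) (D : Set ι) (c : ℝ) :
    IsSelfAdjoint (heckeOp σ D c) :=
  (isSelfAdjoint_permOp hσ).add
    (IsSelfAdjoint.smul (isSelfAdjoint_iff.2 (Complex.conj_ofReal c)) (isSelfAdjoint_coordProj D))

lemma permOp_mul_heckeOp_mul_permOp {τ : Equiv.Perm ι} (hτ : Function.Involutive τ)
    (σ : Equiv.Perm ι) (D : Set ι) (c : ℝ) :
    permOp τ * heckeOp σ D c * permOp τ = heckeOp (τ * σ * τ) (τ ⁻¹' D) c := by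
  classical
  ext f n
  simp only [mul_apply_eq_comp, permOp_apply, heckeOp_apply, Set.indicator_apply, mem_preimage,
    Equiv.Perm.mul_apply, hτ n]

lemma heckeOp_mul_self {σ : Equiv.Perm ι} (hσ : Function.Involutive σ) {D : Set ι}
    (hD : ∀ n, σ n ∈ D ↔ n ∉ D) (c : ℝ) :
    heckeOp σ D c * heckeOp σ D c = 1 + (c : ℂ) • heckeOp σ D c := by
  ext f n
  change heckeOp σ D c (heckeOp σ D c f) n = f n + c * heckeOp σ D c f n
  by_cases h : n ∈ D <;> simp [heckeOp_apply, hσ n, hD, h]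

lemma heckeOp_commute {σ ρ : Equiv.Perm ι} {D E : Set ι} (hσρ : ∀ n, σ (ρ n) = ρ (σ n))
    (h : ∀ n, (σ n = ρ n ∧ (σ n ∈ E ↔ ρ n ∈ D) ∧ (n ∈ D ↔ n ∈ E)) ∨
      ((σ n ∈ E ↔ n ∈ E) ∧ (ρ n ∈ D ↔ n ∈ D))) (c : ℝ) :
    Commute (heckeOp σ D c) (heckeOp ρ E c) := by
  classical
  ext f n
  change heckeOp σ D c (heckeOp ρ E c f) n = heckeOp ρ E c (heckeOp σ D c f) n
  simp only [heckeOp_apply, Set.indicator_apply, hσρ]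
  rcases h n with ⟨h1, h2, h3⟩ | ⟨h1, h2⟩
  · simp only [h2, h3]
    rw [h1]
  · simp only [h1, h2]
    by_cases h4 : n ∈ E <;> by_cases h5 : n ∈ D <;> simp [h4, h5]; ring

variable [DecidableEq ι]

/-- The standard basis vectors of `ℓ²`. -/
noncomputable def stdVec (n : ι) : ℓ²(ι, ℂ) := lp.single 2 n (1 : ℂ)

lemma stdVec_apply (n m : ι) : stdVec n m = if m = n then 1 else 0 := by
  rw [stdVec, lp.single_apply, Pi.single_apply]

lemma inner_stdVec_left (n : ι) (f : ℓ²(ι, ℂ)) : inner ℂ (stdVec n) f = f n := by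
  rw [stdVec, lp.inner_single_left, RCLike.inner_apply, map_one, mul_one]

lemma norm_stdVec (n : ι) : ‖stdVec n‖ = 1 := by
  rw [stdVec, lp.norm_single two_pos, norm_one]

lemma permOp_stdVec {σ : Equiv.Perm ι} (hσ : Function.Involutive σ) (m : ι) :
    permOp σ (stdVec m) = stdVec (σ m) := by
  ext n
  rw [permOp_apply, stdVec_apply, stdVec_apply]
  simp only [hσ.eq_iff]

lemma coordProj_stdVec_of_notMem {D : Set ι} {m : ι} (hm : m ∉ D) :
    coordProj D (stdVec m) = 0 := by
  ext n
  refine Set.indicator_apply_eq_zero.2 fun hn => ?_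
  rw [stdVec_apply, if_neg (ne_of_mem_of_not_mem hn hm)]

lemma heckeOp_stdVec {σ : Equiv.Perm ι} (hσ : Function.Involutive σ) {D : Set ι} (c : ℝ) {m : ι}
    (hm : m ∉ D) : heckeOp σ D c (stdVec m) = stdVec (σ m) := by
  rw [heckeOp, add_apply, smul_apply, permOp_stdVec hσ, coordProj_stdVec_of_notMem hm, smul_zero,
    add_zero]

lemma continuousLinearMap_ext_stdVec {E : Type*} [NormedAddCommGroup E] [NormedSpace ℂ E]
    {S T : ℓ²(ι, ℂ) →L[ℂ] E} (h : ∀ n, S (stdVec n) = T (stdVec n)) : S = T := by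
  ext f
  refine ((lp.hasSum_single ENNReal.ofNat_ne_top f).mapL S).unique ?_
  convert (lp.hasSum_single ENNReal.ofNat_ne_top f).mapL T using 2 with n
  have hsingle : lp.single 2 n (f n) = f n • stdVec n := by
    rw [stdVec, ← lp.single_smul, smul_eq_mul, mul_one]
  rw [hsingle, map_smul, map_smul, h]

end SequenceSpace

section AltProd

variable {A : Type*} [Monoid A]

lemma commute_altProd {a x y : A} (hx : Commute a x) (hy : Commute a y) (n : ℕ) :
    Commute a (altProd n x y) := by
  induction n generalizing x y with
  | zero => exact Commute.one_right a
  | succ n ih => exact hx.mul_right (ih hy hx)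

lemma star_altProd [StarMul A] {x y : A} (hx : IsSelfAdjoint x) (hy : IsSelfAdjoint y) (n : ℕ) :
    star (altProd n x y) = if Even n then altProd n y x else altProd n x y := by
  obtain ⟨k, rfl | rfl⟩ := n.even_or_odd'
  · rw [if_pos (even_two_mul k), ← mul_pow_eq_altProd, ← mul_pow_eq_altProd, star_pow, star_mul,
      hx.star_eq, hy.star_eq]
  · rw [if_neg (Nat.not_even_two_mul_add_one k), ← mul_pow_mul_eq_altProd, star_mul, star_pow,
      star_mul, hx.star_eq, hy.star_eq, mul_pow_mul]

end AltProd

section DihedralHecke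

open scoped lp

/-- The integer coding the one-letter word in a generator of the infinite dihedral group. The
reduced word of length `k` starting with the generator `i` is coded by `wordSign i * k`, so that
`ℤ` codes the whole group. -/
def wordSign : Fin 2 → ℤ := ![1, -1]

lemma wordSign_eq_neg_of_ne {i j : Fin 2} (h : i ≠ j) : wordSign j = -wordSign i := by
  revert i j
  decide

lemma wordSign_eq (i : Fin 2) : wordSign i = 1 ∨ wordSign i = -1 := by
  revert i
  decide

lemma exists_eq_wordSign_mul (n : ℤ) : ∃ (i : Fin 2) (k : ℕ), n = wordSign i * k := by
  obtain ⟨k, rfl | rfl⟩ := n.eq_nat_or_neg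
  · exact ⟨0, k, (one_mul _).symm⟩
  · exact ⟨1, k, (neg_one_mul _).symm⟩

/-- Left multiplication by a generator, on coded words. -/
def leftPerm (i : Fin 2) : Equiv.Perm ℤ := Equiv.subLeft (wordSign i)

/-- The coded words that are shortened by left multiplication by a generator. -/
def leftDescent (i : Fin 2) : Set ℤ := {n | 0 < wordSign i * n}

/-- Inversion of coded words: the reduced words of odd length are palindromes, those of even length
`n` are inverted by changing the first letter. -/
def wordInv : Equiv.Perm ℤ :=
  Function.Involutive.toPerm (fun n : ℤ => if Even n then -n else n) fun n => by
    by_cases h : Even n <;> simp [h]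

lemma wordInv_apply (n : ℤ) : wordInv n = if Even n then -n else n := rfl

lemma wordInv_involutive : Function.Involutive wordInv :=
  Function.Involutive.toPerm_involutive _

lemma wordInv_wordSign_mul (i : Fin 2) (k : ℕ) :
    wordInv (wordSign i * k) = if Even k then -(wordSign i * k) else wordSign i * k := by
  rcases wordSign_eq i with h | h <;> simp [h, wordInv_apply]

lemma leftPerm_apply (i : Fin 2) (n : ℤ) : leftPerm i n = wordSign i - n := rfl

lemma mem_leftDescent {i : Fin 2} {n : ℤ} : n ∈ leftDescent i ↔ 0 < wordSign i * n := Iff.rfl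

lemma leftPerm_involutive (i : Fin 2) : Function.Involutive (leftPerm i) :=
  sub_sub_cancel (wordSign i)

lemma leftPerm_mem_leftDescent (i : Fin 2) (n : ℤ) :
    leftPerm i n ∈ leftDescent i ↔ n ∉ leftDescent i := by
  rw [mem_leftDescent, mem_leftDescent, leftPerm_apply]
  rcases wordSign_eq i with h | h <;> rw [h] <;> omega

/-- The operator of left multiplication by a generator of the Hecke algebra. -/
noncomputable def leftOp (c : ℝ) (i : Fin 2) : ℓ²(ℤ, ℂ) →L[ℂ] ℓ²(ℤ, ℂ) :=
  heckeOp (leftPerm i) (leftDescent i) c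

lemma isSelfAdjoint_leftOp (c : ℝ) (i : Fin 2) : IsSelfAdjoint (leftOp c i) :=
  isSelfAdjoint_heckeOp (leftPerm_involutive i) _ c

lemma leftOp_mul_self (c : ℝ) (i : Fin 2) :
    leftOp c i * leftOp c i = 1 + (c : ℂ) • leftOp c i :=
  heckeOp_mul_self (leftPerm_involutive i) (leftPerm_mem_leftDescent i) c

lemma leftOp_stdVec (c : ℝ) {i j : Fin 2} (hij : i ≠ j) (k : ℕ) :
    leftOp c i (stdVec (wordSign j * k)) = stdVec (wordSign i * (k + 1 : ℕ)) := by
  rw [wordSign_eq_neg_of_ne hij, leftOp, heckeOp_stdVec (leftPerm_involutive i), leftPerm_apply]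
  · push_cast
    ring_nf
  · rw [mem_leftDescent]
    rcases wordSign_eq i with h | h <;> rw [h] <;> omega

/-- The operator of right multiplication by a generator of the Hecke algebra, which word inversion
conjugates to the left multiplication. -/
noncomputable def rightOp (c : ℝ) (i : Fin 2) : ℓ²(ℤ, ℂ) →L[ℂ] ℓ²(ℤ, ℂ) :=
  permOp wordInv * leftOp c i * permOp wordInv

lemma isSelfAdjoint_rightOp (c : ℝ) (i : Fin 2) : IsSelfAdjoint (rightOp c i) :=
  (isSelfAdjoint_leftOp c i).conjugate_self (isSelfAdjoint_permOp wordInv_involutive)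

lemma rightOp_stdVec (c : ℝ) {i j : Fin 2} (hij : i ≠ j) (k : ℕ) :
    rightOp c i (stdVec (wordInv (wordSign j * k))) =
      stdVec (wordInv (wordSign i * (k + 1 : ℕ))) := by
  rw [rightOp, mul_apply_eq_comp, mul_apply_eq_comp, permOp_stdVec wordInv_involutive,
    wordInv_involutive, leftOp_stdVec c hij, permOp_stdVec wordInv_involutive]

lemma altProd_rightOp_stdVec_zero (c : ℝ) {i j : Fin 2} (hij : i ≠ j) (k : ℕ) :
    altProd k (rightOp c i) (rightOp c j) (stdVec 0) = stdVec (wordInv (wordSign i * k)) := by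
  induction k generalizing i j with
  | zero => simp [altProd, wordInv_apply]
  | succ k ih => rw [altProd_succ, mul_apply_eq_comp, ih hij.symm, rightOp_stdVec c hij]

lemma star_altProd_rightOp_stdVec_zero (c : ℝ) {i j : Fin 2} (hij : i ≠ j) (k : ℕ) :
    star (altProd k (rightOp c i) (rightOp c j)) (stdVec 0) = stdVec (wordSign i * k) := by
  rw [star_altProd (isSelfAdjoint_rightOp c i) (isSelfAdjoint_rightOp c j)]
  split_ifs with hk
  · rw [altProd_rightOp_stdVec_zero c hij.symm, wordInv_wordSign_mul, if_pos hk,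
      wordSign_eq_neg_of_ne hij, neg_mul, neg_neg]
  · rw [altProd_rightOp_stdVec_zero c hij, wordInv_wordSign_mul, if_neg hk]

lemma leftOp_commute_rightOp (c : ℝ) (i j : Fin 2) : Commute (leftOp c i) (rightOp c j) := by
  rw [leftOp, rightOp, leftOp, permOp_mul_heckeOp_mul_permOp wordInv_involutive]
  refine heckeOp_commute (fun n => ?_) (fun n => ?_) c
  all_goals
    simp only [Equiv.Perm.mul_apply, leftPerm_apply, mem_preimage, mem_leftDescent, wordInv_apply,
      Int.even_iff]
    rcases wordSign_eq i with h | h <;> rcases wordSign_eq j with h' | h' <;> rw [h, h'] <;>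
      split_ifs <;> omega

/-- The Hecke von Neumann algebra of the infinite dihedral group, as the commutant of the right
multiplications. -/
noncomputable def heckeVN (c : ℝ) : VonNeumannAlgebra ℓ²(ℤ, ℂ) :=
  commutantOfSet (range (rightOp c))

lemma mem_heckeVN {c : ℝ} {a : ℓ²(ℤ, ℂ) →L[ℂ] ℓ²(ℤ, ℂ)} :
    a ∈ (heckeVN c).toStarSubalgebra ↔ ∀ i, Commute (rightOp c i) a :=
  (mem_commutantOfSet (forall_mem_range.2 (isSelfAdjoint_rightOp c))).trans forall_mem_range

lemma leftOp_mem_heckeVN (c : ℝ) (i : Fin 2) : leftOp c i ∈ (heckeVN c).toStarSubalgebra :=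
  mem_heckeVN.2 fun j => (leftOp_commute_rightOp c i j).symm

lemma exists_commute_apply_stdVec_zero (c : ℝ) (n : ℤ) :
    ∃ X : ℓ²(ℤ, ℂ) →L[ℂ] ℓ²(ℤ, ℂ), (∀ a ∈ (heckeVN c).toStarSubalgebra, Commute a X) ∧
      X (stdVec 0) = stdVec n ∧ star X (stdVec 0) = stdVec (wordInv n) := by
  obtain ⟨i, k, hn⟩ := exists_eq_wordSign_mul (wordInv n)
  obtain ⟨j, hji⟩ := exists_ne i
  refine ⟨altProd k (rightOp c i) (rightOp c j),
    fun a ha => commute_altProd (mem_heckeVN.1 ha i).symm (mem_heckeVN.1 ha j).symm k, ?_, ?_⟩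
  · rw [altProd_rightOp_stdVec_zero c hji.symm, ← hn, wordInv_involutive]
  · rw [star_altProd_rightOp_stdVec_zero c hji.symm, hn]

lemma eq_zero_of_mem_heckeVN {c : ℝ} {a : ℓ²(ℤ, ℂ) →L[ℂ] ℓ²(ℤ, ℂ)}
    (ha : a ∈ (heckeVN c).toStarSubalgebra) (h0 : a (stdVec 0) = 0) : a = 0 :=
  continuousLinearMap_ext_stdVec fun n => by
    obtain ⟨X, hX, hXn, -⟩ := exists_commute_apply_stdVec_zero c n
    rw [← hXn, ← mul_apply_eq_comp, (hX a ha).eq, mul_apply_eq_comp, h0, map_zero, zero_apply]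

lemma star_apply_stdVec_zero {c : ℝ} {a : ℓ²(ℤ, ℂ) →L[ℂ] ℓ²(ℤ, ℂ)}
    (ha : a ∈ (heckeVN c).toStarSubalgebra) (n : ℤ) :
    star a (stdVec 0) n = star (a (stdVec 0) (wordInv n)) := by
  obtain ⟨X, hX, hXn, hXinv⟩ := exists_commute_apply_stdVec_zero c n
  calc star a (stdVec 0) n = inner ℂ (X (stdVec 0)) (star a (stdVec 0)) := by
        rw [hXn, inner_stdVec_left]
    _ = inner ℂ (a (X (stdVec 0))) (stdVec 0) :=
        ContinuousLinearMap.adjoint_inner_right a (X (stdVec 0)) (stdVec 0)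
    _ = inner ℂ (X (a (stdVec 0))) (stdVec 0) := by
        rw [← mul_apply_eq_comp, (hX a ha).eq, mul_apply_eq_comp]
    _ = inner ℂ (a (stdVec 0)) (star X (stdVec 0)) :=
        (ContinuousLinearMap.adjoint_inner_right X (a (stdVec 0)) (stdVec 0)).symm
    _ = star (a (stdVec 0) (wordInv n)) := by
        rw [hXinv, ← inner_conj_symm, inner_stdVec_left, Complex.star_def]

/-- The canonical trace of the Hecke von Neumann algebra. -/
noncomputable def heckeTrace (c : ℝ) : (heckeVN c).toStarSubalgebra →ₗ[ℂ] ℂ :=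
  vectorFunctional (heckeVN c) (stdVec 0)

lemma heckeTrace_mul (c : ℝ) (a b : (heckeVN c).toStarSubalgebra) :
    heckeTrace c (a * b) = ∑' n, (a : ℓ²(ℤ, ℂ) →L[ℂ] ℓ²(ℤ, ℂ)) (stdVec 0) (wordInv n) *
      (b : ℓ²(ℤ, ℂ) →L[ℂ] ℓ²(ℤ, ℂ)) (stdVec 0) n := by
  rw [heckeTrace, ← star_star a, vectorFunctional_star_mul, lp.inner_eq_tsum]
  refine tsum_congr fun n => ?_
  rw [StarMemClass.coe_star, star_apply_stdVec_zero a.2, star_star, RCLike.inner_apply,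
    Complex.star_def, Complex.conj_conj, mul_comm]

lemma heckeTrace_mul_comm (c : ℝ) (a b : (heckeVN c).toStarSubalgebra) :
    heckeTrace c (a * b) = heckeTrace c (b * a) := by
  rw [heckeTrace_mul, heckeTrace_mul, ← Equiv.tsum_eq wordInv]
  refine tsum_congr fun n => ?_
  rw [wordInv_involutive, mul_comm]

lemma isNormalTracialState_heckeTrace (c : ℝ) : IsNormalTracialState (heckeVN c) (heckeTrace c) :=
  isNormalTracialState_vectorFunctional (norm_stdVec 0) (heckeTrace_mul_comm c)

lemma isFaithfulFunctional_heckeTrace (c : ℝ) : IsFaithfulFunctional (heckeTrace c) :=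
  isFaithfulFunctional_vectorFunctional fun a ha => Subtype.ext (eq_zero_of_mem_heckeVN a.2 ha)

/-- The generators of the Hecke von Neumann algebra, normalized by
`heckeGen c i ^ 2 = 1 + c • heckeGen c i`. -/
noncomputable def heckeGen (c : ℝ) (i : Fin 2) : (heckeVN c).toStarSubalgebra :=
  ⟨leftOp c i, leftOp_mem_heckeVN c i⟩

lemma heckeGen_mul_self (c : ℝ) (i : Fin 2) :
    heckeGen c i * heckeGen c i = 1 + (c : ℂ) • heckeGen c i :=
  Subtype.ext (leftOp_mul_self c i)

lemma isSelfAdjoint_heckeGen (c : ℝ) (i : Fin 2) : IsSelfAdjoint (heckeGen c i) :=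
  Subtype.ext (isSelfAdjoint_leftOp c i)

lemma exists_prod_heckeGen_stdVec_zero (c : ℝ) (n : ℕ) (i : Fin (n + 1) → Fin 2)
    (hi : ∀ k : Fin n, i k.castSucc ≠ i k.succ) (β : Fin (n + 1) → ℂ) :
    ∃ γ : ℂ, ((List.ofFn fun k => β k • heckeGen c (i k)).prod : ℓ²(ℤ, ℂ) →L[ℂ] ℓ²(ℤ, ℂ))
      (stdVec 0) = γ • stdVec (wordSign (i 0) * (n + 1 : ℕ)) := by
  induction n with
  | zero =>
    obtain ⟨j, hj⟩ := exists_ne (i 0)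
    refine ⟨β 0, ?_⟩
    have h := leftOp_stdVec c hj.symm 0
    rw [Nat.cast_zero, mul_zero] at h
    rw [← h]
    simp [heckeGen]
  | succ n ih =>
    obtain ⟨γ, hγ⟩ := ih (fun k => i k.succ) (fun k => hi k.succ) (fun k => β k.succ)
    refine ⟨γ * β 0, ?_⟩
    rw [List.ofFn_succ, List.prod_cons, MulMemClass.coe_mul, mul_apply_eq_comp, hγ, map_smul,
      mul_smul]
    exact congrArg (fun v => γ • β 0 • v) (leftOp_stdVec c (hi 0) (n + 1))

lemma heckeTrace_prod_heckeGen (c : ℝ) (n : ℕ) (i : Fin (n + 1) → Fin 2)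
    (hi : ∀ k : Fin n, i k.castSucc ≠ i k.succ) (β : Fin (n + 1) → ℂ) :
    heckeTrace c (List.ofFn fun k => β k • heckeGen c (i k)).prod = 0 := by
  obtain ⟨γ, hγ⟩ := exists_prod_heckeGen_stdVec_zero c n i hi β
  have hne : (0 : ℤ) ≠ wordSign (i 0) * (n + 1 : ℕ) := by
    rcases wordSign_eq (i 0) with h | h <;> rw [h] <;> omega
  rw [heckeTrace, vectorFunctional_apply, hγ, inner_smul_right, inner_stdVec_left, stdVec_apply,
    if_neg hne, mul_zero]

lemma heckeTrace_heckeGen (c : ℝ) (i : Fin 2) : heckeTrace c (heckeGen c i) = 0 := by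
  simpa using heckeTrace_prod_heckeGen c 0 (fun _ => i) Fin.elim0 1

end DihedralHecke

section Model

/-- The parameter of the Hecke algebra in which `heckeProj p i` is a projection. It takes the junk
value `0` if `p = 0` or `p = 1`, when `heckeProj p i` is the scalar `p`. -/
noncomputable def heckeParam (p : ℝ) : ℝ := (1 - 2 * p) / √(p * (1 - p))

/-- The spectral projection of a generator of the Hecke algebra, of trace `p`. -/
noncomputable def heckeProj (p : ℝ) (i : Fin 2) : (heckeVN (heckeParam p)).toStarSubalgebra :=
  (p : ℂ) • 1 + (√(p * (1 - p)) : ℂ) • heckeGen (heckeParam p) i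

variable {p : ℝ}

lemma sqrt_mul_sqrt_mul_heckeParam (p : ℝ) :
    √(p * (1 - p)) * (√(p * (1 - p)) * heckeParam p) = √(p * (1 - p)) * (1 - 2 * p) := by
  by_cases h : √(p * (1 - p)) = 0
  · rw [h, zero_mul, zero_mul]
  · rw [heckeParam, mul_div_cancel₀ _ h]

lemma heckeTrace_heckeProj (p : ℝ) (i : Fin 2) : heckeTrace (heckeParam p) (heckeProj p i) = p := by
  rw [heckeProj, map_add, map_smul, map_smul, heckeTrace_heckeGen,
    (isNormalTracialState_heckeTrace _).map_one, smul_zero, add_zero, smul_eq_mul, mul_one]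

lemma isStarProjection_heckeProj (hp : p ∈ Icc (0 : ℝ) 1) (i : Fin 2) :
    IsStarProjection (heckeProj p i) where
  isIdempotentElem := by
    have hsq : (√(p * (1 - p)) : ℂ) * √(p * (1 - p)) = p * (1 - p) := by
      exact_mod_cast Real.mul_self_sqrt (mul_nonneg hp.1 (sub_nonneg.2 hp.2))
    have hparam : (√(p * (1 - p)) : ℂ) * (√(p * (1 - p)) * heckeParam p) =
        √(p * (1 - p)) * (1 - 2 * p) := by
      exact_mod_cast sqrt_mul_sqrt_mul_heckeParam p
    rw [IsIdempotentElem, heckeProj]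
    generalize (√(p * (1 - p)) : ℂ) = r at hsq hparam ⊢
    simp only [add_mul, mul_add, smul_mul_smul_comm, one_mul, mul_one, heckeGen_mul_self, smul_add,
      smul_smul]
    rw [mul_assoc r r, hparam, hsq]
    module
  isSelfAdjoint := .add (.smul (Complex.conj_ofReal _) (.one _))
    (.smul (Complex.conj_ofReal _) (isSelfAdjoint_heckeGen _ i))

lemma exists_eq_smul_heckeGen (hp : p ∈ Icc (0 : ℝ) 1) {i : Fin 2}
    {x : (heckeVN (heckeParam p)).toStarSubalgebra}
    (hx : x ∈ StarAlgebra.adjoin ℂ {heckeProj p i}) (hx0 : heckeTrace (heckeParam p) x = 0) :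
    ∃ β : ℂ, x = β • heckeGen (heckeParam p) i := by
  obtain ⟨β, rfl⟩ := exists_eq_smul_sub_of_mem_adjoin (isNormalTracialState_heckeTrace _).map_one
    (isStarProjection_heckeProj hp i) hx hx0
  exact ⟨β * √(p * (1 - p)), by rw [heckeTrace_heckeProj, heckeProj, add_sub_cancel_left, mul_smul]⟩

lemma freelyIndependent_heckeProj (hp : p ∈ Icc (0 : ℝ) 1) :
    FreelyIndependent (heckeTrace (heckeParam p)) (heckeProj p 0) (heckeProj p 1) := by
  have hB : ![StarAlgebra.adjoin ℂ {heckeProj p 0}, StarAlgebra.adjoin ℂ {heckeProj p 1}] =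
      fun i => StarAlgebra.adjoin ℂ {heckeProj p i} :=
    funext (Fin.forall_fin_two.2 ⟨rfl, rfl⟩)
  rw [FreelyIndependent, hB]
  intro n i x hi hx hx0
  choose β hβ using fun k => exists_eq_smul_heckeGen hp (hx k) (hx0 k)
  obtain rfl := funext hβ
  exact heckeTrace_prod_heckeGen _ n i hi β

end Model

lemma SameDistribution.map_sq_eq {A : Type*} [Ring A] [Algebra ℂ A] {φ : A →ₗ[ℂ] ℂ} {e y : A}
    (hd : SameDistribution φ y (-e)) (he : IsIdempotentElem e) : φ (y ^ 2) = φ e := by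
  rw [hd 2, neg_sq, sq, he.eq]

section Minimum

variable {A : Type*} [CStarAlgebra A] {φ : A →ₗ[ℂ] ℂ}

lemma IsState.isLeast_re_map_sq (h : IsState φ) {e y : A} (he : IsStarProjection e) {p : ℝ}
    (hpe : φ e = p) (hp_half : p ≠ 1 / 2) (hy : IsSelfAdjoint y)
    (hfree : FreelyIndependent φ e y) (hd : SameDistribution φ y (-e)) :
    y ∈ freeSymmetrizers φ e ∧ φ (y ^ 2) = p ∧
      IsLeast ((fun x => (φ (x ^ 2)).re) '' freeSymmetrizers φ e) p := by
  have hmem : y ∈ freeSymmetrizers φ e :=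
    ⟨hy, hfree, hfree.map_odd_pow_add h.continuous h.map_one hd⟩
  have hsq : φ (y ^ 2) = p := (hd.map_sq_eq he.isIdempotentElem).trans hpe
  exact ⟨hmem, hsq, ⟨y, hmem, by simp [hsq]⟩, forall_mem_image.2 fun x hx =>
    h.le_re_map_sq_of_mem_freeSymmetrizers he hpe hp_half hx⟩

end Minimum

theorem theorem2_general (p : ℝ) (hp : p ∈ Icc (0 : ℝ) 1) (hp_half : p ≠ 1 / 2) :
    (∀ (A : Type*) [CStarAlgebra A] (φ : A →ₗ[ℂ] ℂ), IsState φ →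
      ∀ e : A, IsStarProjection e → φ e = (p : ℂ) →
        (∀ y ∈ freeSymmetrizers φ e, p ≤ (φ (y ^ 2)).re) ∧
        (∀ y, IsSelfAdjoint y → FreelyIndependent φ e y → SameDistribution φ y (-e) →
          y ∈ freeSymmetrizers φ e ∧ φ (y ^ 2) = (p : ℂ) ∧
          IsLeast ((fun x => (φ (x ^ 2)).re) '' freeSymmetrizers φ e) p)) ∧
    (∃ (H : Type) (_ : NormedAddCommGroup H) (_ : InnerProductSpace ℂ H) (_ : CompleteSpace H)
      (M : VonNeumannAlgebra H) (φ : M.toStarSubalgebra →ₗ[ℂ] ℂ) (e y : M.toStarSubalgebra),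
      IsNormalTracialState M φ ∧ IsFaithfulFunctional φ ∧
      IsStarProjection e ∧ φ e = (p : ℂ) ∧
      y ∈ freeSymmetrizers φ e ∧ SameDistribution φ y (-e) ∧ φ (y ^ 2) = (p : ℂ) ∧
      IsLeast ((fun x => (φ (x ^ 2)).re) '' freeSymmetrizers φ e) p) := by
  refine ⟨fun A _ φ h e he hpe =>
    ⟨fun y hy => h.le_re_map_sq_of_mem_freeSymmetrizers he hpe hp_half hy,
      fun y hy hfree hd => h.isLeast_re_map_sq he hpe hp_half hy hfree hd⟩, ?_⟩
  have hφ := isNormalTracialState_heckeTrace (heckeParam p)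
  have he := isStarProjection_heckeProj hp
  have hpe := heckeTrace_heckeProj p
  have hd := sameDistribution_neg_of_isIdempotentElem (he 1).isIdempotentElem
    (he 0).isIdempotentElem ((hpe 1).trans (hpe 0).symm)
  have := isClosed_coe_vonNeumannAlgebra (heckeVN (heckeParam p))
  obtain ⟨hmem, hsq, hleast⟩ := hφ.isState.isLeast_re_map_sq (he 0) (hpe 0) hp_half
    (he 1).isSelfAdjoint.neg (freelyIndependent_heckeProj hp).neg_right hd
  exact ⟨_, _, _, _, heckeVN (heckeParam p), heckeTrace (heckeParam p), heckeProj p 0,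
    -heckeProj p 1, hφ, isFaithfulFunctional_heckeTrace _, he 0, hpe 0, hmem, hd, hsq, hleast⟩

end FreeSymmetrization

theorem theorem2 (p : ℝ) (hp : p ∈ Set.Icc (0 : ℝ) 1) (hp_half : p ≠ 1 / 2) :
    -- in every tracial W*-probability space, `p` is a lower bound, and it is the minimum,
    -- attained at `y`, as soon as there is a `y` free from `e` and distributed as `-e`
    (∀ (H : Type*) [NormedAddCommGroup H] [InnerProductSpace ℂ H] [CompleteSpace H]
      (M : VonNeumannAlgebra H) (φ : M.toStarSubalgebra →ₗ[ℂ] ℂ),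
      IsNormalTracialState M φ →
      ∀ e : M.toStarSubalgebra, IsStarProjection e → φ e = (p : ℂ) →
        (∀ y ∈ freeSymmetrizers φ e, p ≤ (φ (y ^ 2)).re) ∧
        (∀ y, IsSelfAdjoint y → FreelyIndependent φ e y → SameDistribution φ y (-e) →
          y ∈ freeSymmetrizers φ e ∧ φ (y ^ 2) = (p : ℂ) ∧
          IsLeast ((fun x => (φ (x ^ 2)).re) '' freeSymmetrizers φ e) p)) ∧
    -- such a `y` exists in a suitable tracial W*-probability space, so the minimum is attained
    (∃ (H : Type) (_ : NormedAddCommGroup H) (_ : InnerProductSpace ℂ H) (_ : CompleteSpace H)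
      (M : VonNeumannAlgebra H) (φ : M.toStarSubalgebra →ₗ[ℂ] ℂ) (e y : M.toStarSubalgebra),
      IsNormalTracialState M φ ∧ IsFaithfulFunctional φ ∧
      IsStarProjection e ∧ φ e = (p : ℂ) ∧
      y ∈ freeSymmetrizers φ e ∧ SameDistribution φ y (-e) ∧ φ (y ^ 2) = (p : ℂ) ∧
      IsLeast ((fun x => (φ (x ^ 2)).re) '' freeSymmetrizers φ e) p) := by
  refine (theorem2_general p hp hp_half).imp_left fun hmin H _ _ _ M φ hφ => ?_
  have := isClosed_coe_vonNeumannAlgebra M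
  exact hmin M.toStarSubalgebra φ hφ.isState
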